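/- Let $I\subseteq\mathbb R$ be an interval of nonzero length, $a:=\inf I\in[-\infty,\infty)$, $b:=\sup I\in(-\infty,\infty]$, and let $w_0,w_1,\dots$ be strictly positive Borel functions on $I$, each bounded on every compact subset of $I$. For a strictly positive Borel $w$ on $I$, let $\mathcal L_w$ be the set of all Borel $f\colon I\to\mathbb R$ for which there is a (necessarily unique) Borel function $D_wf\colon I\to\mathbb R$ such that $f(x)=f(z)+\int_z^x(D_wf)(u)\,du$ for all $x,z\in I$ (with finite Lebesgue integrals) and $(D_wf)/w$ is right-continuous on $I\setminus\{b\}$ and, if $b\in I$, left-continuous at $b$. Put $\mathcal L^0:=\{\text{Borel }f\colon I\to\mathbb R\}$, $f^{(0)}:=f/w_0$, and recursively $\mathcal L^{j}:=\{f\in\mathcal L^{j-1}: f^{(j-1)}\in\mathcal L_{w_j}\}$, $f^{(j)}:=(D_{w_j}f^{(j-1)})/w_j$ for $f\in\mathcal L^j$, $j\ge1$. Fix integers $n\ge0$ and $1\le k\le n+1$, and let $$\mathcal F_+^{k:n}:=\{f\in\mathcal L^n: f^{(j)}\text{ is nondecreasing for each integer } j \text{ with } k-1\le j\le n\},$$ $$\mathsf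 P_+^{k:n}:=\{p\in\mathcal L^{n+1}: p^{(n+1)}=0\}\cap\mathcal F_+^{k:n}.$$ For $t\in I$ or $t=a$ and $0\le j\le m$ define functions on $I$ by $p_{t;m,m}:=w_m$ and $p_{t;j,m}(x):=w_j(x)\int_{t+}^{x}p_{t;j+1,m}(u)\,du$ if $j<m$ (with $\int_t^x:=-\int_x^t$ for $x<t$); for $t\in I$ these are real-valued, while $p_{a;j,m}$ takes values in $[0,\infty]$ (with all integrals over $I\cap(-\infty,x)$). For $t\in I$ put $p^+_{t;0,n}(x):=p_{t;0,n}(x)\,\mathbf 1\{x\ge t\}$. Let $$F_{k,n}:=\{j\in\mathbb Z: k\le j\le n,\ p_{a;k,j}(x)<\infty\text{ for all }x\in I\}.$$ For $z\in I$ and $j\in F_{k,n}$ put $p_{a,z;k:k:j}:=p_{a;k,j}$ and $p_{a,z;i:k:j}(x):=w_i(x)\int_z^xp_{a,z;i+1:k:j}(u)\,du$ for $0\le i<k$, $x\in I$. For a nonnegative (not necessarily finite) Borel measure $\nu$ on $I$ and a Borel function $f\colon I\to\mathbb R$, the integral $\nu(f):=\nu(f_+)-\nu(f_-)\in[-\infty,\infty]$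 exists if $\nu(f_+)<\infty$ or $\nu(f_-)<\infty$; any assertion about $\nu(f)$ below includes the existence of $\nu(f)$. Let $\mathcal G$ be any set of functions with $$\mathsf P_+^{k:n}\cup\{p^+_{t;0,n}: t\in I\}\subseteq\mathcal G\subseteq\mathcal F_+^{k:n},$$ let $\mathcal N_+(\mathcal G)$ be the set of all nonnegative Borel measures $\nu$ on $I$ with $\nu(f)>-\infty$ for all $f\in\mathcal G$, and let $$\hat{\mathcal G}:=\{(\nu_1,\nu_2)\in\mathcal N_+(\mathcal G)\times\mathcal N_+(\mathcal G): \nu_1(f)\ge\nu_2(f)\text{ for all }f\in\mathcal G\}.$$ **Theorem.** Take any $(\nu_1,\nu_2)\in\mathcal N_+(\mathcal G)\times\mathcal N_+(\mathcal G)$ and any $s,z\in I$. Then $(\nu_1,\nu_2)\in\hat{\mathcal G}$ if and only if all of the following hold: (i$'$) $\nu_1(p_{s;0,i})=\nu_2(p_{s;0,i})\in\mathbb R$ for all $i\in\{0,\dots,k-1\}$; (ii$'$) $\nu_1(p_{a,z;0:k:j})\ge\nu_2(p_{a,z;0:k:j})$ for all $j\in F_{k,n}$; (iii) $\nu_1(p^+_{t;0,n})\ge\nu_2(p^+_{t;0,n})$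 for all $t\in I$. -/

import Mathlib

open MeasureTheory Set
open scoped ENNReal

noncomputable section

namespace GaugedCone

/-- Extension of a function on `I` by zero to the whole line.  It is used only in order to integrate
over subintervals of `I`, where it agrees with the given function. -/
def extendZero {β : Type} [Zero β] {I : Set ℝ} (f : I → β) (u : ℝ) : β :=
  open Classical in if h : u ∈ I then f ⟨u, h⟩ else 0

/-- The class `LD(I)`: right-continuous at every point of `I` except the right endpoint (if it
belongs to `I`), and left-continuous at the right endpoint (if it belongs to `I`). -/
def LD (I : Set ℝ) : Set (I → ℝ) :=
  {f | (∀ x : I, ¬ IsTop x → ContinuousWithinAt f (Ici x) x) ∧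
    (∀ x : I, IsTop x → ContinuousWithinAt f (Iic x) x)}

/-- `g` is a `w`-derivative of `f`: both are Borel, `g / w ∈ LD(I)`, and
`f x = f z + ∫_z^x g` for all `x, z ∈ I`, the integral being a finite Lebesgue integral. -/
def IsGenDeriv {I : Set ℝ} (w f g : I → ℝ) : Prop :=
  Measurable f ∧ Measurable g ∧ (fun x => g x / w x) ∈ LD I ∧
    ∀ x z : I, IntervalIntegrable (extendZero g) volume z x ∧
      f x = f z + ∫ u in (z : ℝ)..x, extendZero g u

/-- The domain `L_w` of the generalized differentiation operator `D_w`. -/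
def genDom {I : Set ℝ} (w : I → ℝ) : Set (I → ℝ) := {f | ∃ g, IsGenDeriv w f g}

/-- The operator `D_w` (with the value `0` outside its domain). -/
def genDeriv {I : Set ℝ} (w f : I → ℝ) : I → ℝ :=
  open Classical in if h : ∃ g, IsGenDeriv w f g then h.choose else 0

/-- A sequence of gauge functions on `I`: Borel, strictly positive, locally bounded. -/
structure IsGauge {I : Set ℝ} (w : ℕ → I → ℝ) : Prop where
  measurable : ∀ i, Measurable (w i)
  pos : ∀ i x, 0 < w i x
  locallyBounded : ∀ i, ∀ K : Set I, IsCompact K → ∃ C : ℝ, ∀ x ∈ K, w i x ≤ C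

/-- The gauged derivative `f^{(j)} = E^j f`:
`E^0 f = f / w_0` and `E^{j+1} f = D_{w_{j+1}} (E^j f) / w_{j+1}`. -/
def gDer {I : Set ℝ} (w : ℕ → I → ℝ) : ℕ → (I → ℝ) → (I → ℝ)
  | 0, f => fun x => f x / w 0 x
  | j + 1, f => fun x => genDeriv (w (j + 1)) (gDer w j f) x / w (j + 1) x

/-- The domain `L^j` of `E^j`. -/
def gDom {I : Set ℝ} (w : ℕ → I → ℝ) : ℕ → Set (I → ℝ)
  | 0 => {f | Measurable f}
  | j + 1 => {f | f ∈ gDom w j ∧ gDer w j f ∈ genDom (w (j + 1))}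

/-- The cone `F_+^{k:n}`: `f ∈ L^n` with `f^{(j)}` nondecreasing for `k - 1 ≤ j ≤ n`. -/
def coneF {I : Set ℝ} (w : ℕ → I → ℝ) (k n : ℕ) : Set (I → ℝ) :=
  {f | f ∈ gDom w n ∧ ∀ j, k ≤ j + 1 → j ≤ n → Monotone (gDer w j f)}

/-- The `w`-polynomials of degree `≤ n`. -/
def wPolyLE {I : Set ℝ} (w : ℕ → I → ℝ) (n : ℕ) : Set (I → ℝ) :=
  {p | p ∈ gDom w (n + 1) ∧ gDer w (n + 1) p = 0}

/-- `P_+^{k:n}`, the `w`-polynomials of degree `≤ n` in the cone `F_+^{k:n}`. -/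
def wPolyCone {I : Set ℝ} (w : ℕ → I → ℝ) (k n : ℕ) : Set (I → ℝ) :=
  wPolyLE w n ∩ coneF w k n

/-- Recursion on `d = m - j` for `p_{t;j,m}`, with base point `t ∈ I`. -/
def ptPolyAux {I : Set ℝ} (w : ℕ → I → ℝ) (t : I) : ℕ → ℕ → I → ℝ
  | 0, j => w j
  | d + 1, j => fun x => w j x * ∫ u in (t : ℝ)..x, extendZero (ptPolyAux w t d (j + 1)) u

/-- `p_{t;j,m}` for `t ∈ I` and `j ≤ m`: `p_{t;m,m} = w_m` and
`p_{t;j,m}(x) = w_j(x) ∫_t^x p_{t;j+1,m}`. -/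
def ptPoly {I : Set ℝ} (w : ℕ → I → ℝ) (t : I) (j m : ℕ) : I → ℝ := ptPolyAux w t (m - j) j

/-- The positive part `p^+_{t;j,m}(x) = p_{t;j,m}(x) 1{x ≥ t}`, for `t ∈ I`. -/
def ptPolyPos {I : Set ℝ} (w : ℕ → I → ℝ) (t : I) (j m : ℕ) (x : I) : ℝ :=
  open Classical in if t ≤ x then ptPoly w t j m x else 0

/-- Recursion on `d = m - j` for `p_{a;j,m}`, where `a = inf I ∈ [-∞, ∞)`. -/
def leftPolyAux {I : Set ℝ} (w : ℕ → I → ℝ) : ℕ → ℕ → I → ℝ≥0∞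
  | 0, j => fun x => ENNReal.ofReal (w j x)
  | d + 1, j => fun x =>
      ENNReal.ofReal (w j x) * ∫⁻ u in Iio (x : ℝ), extendZero (leftPolyAux w d (j + 1)) u

/-- `p_{a;j,m}` for the left endpoint `a = inf I` (in `I` or not, finite or not) and `j ≤ m`, with
values in `[0, ∞]`: `p_{a;m,m} = w_m` and `p_{a;j,m}(x) = w_j(x) ∫_{a+}^x p_{a;j+1,m}`.  The
integral over `(-∞, x)` of the extension by zero is the integral over `I ∩ (-∞, x)`. -/
def leftPoly {I : Set ℝ} (w : ℕ → I → ℝ) (j m : ℕ) : I → ℝ≥0∞ := leftPolyAux w (m - j) j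

/-- The finiteness set `F_{k,n}`: the `j` with `k ≤ j ≤ n` such that `p_{a;k,j} < ∞` on `I`. -/
def finSet {I : Set ℝ} (w : ℕ → I → ℝ) (k n : ℕ) : Set ℕ :=
  {j | k ≤ j ∧ j ≤ n ∧ ∀ x, leftPoly w k j x < ∞}

/-- Recursion on `e = k - i` for `p_{a,z;i:k:j}`. -/
def leftLiftAux {I : Set ℝ} (w : ℕ → I → ℝ) (z : I) (j : ℕ) : ℕ → ℕ → I → ℝ
  | 0, i => fun x => (leftPoly w i j x).toReal
  | e + 1, i => fun x => w i x * ∫ u in (z : ℝ)..x, extendZero (leftLiftAux w z j e (i + 1)) u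

/-- `p_{a,z;i:k:j}` for `i ≤ k ≤ j` with `p_{a;k,j}` finite: `p_{a,z;k:k:j} = p_{a;k,j}` and
`p_{a,z;i:k:j}(x) = w_i(x) ∫_z^x p_{a,z;i+1:k:j}` for `i < k`. -/
def leftLift {I : Set ℝ} (w : ℕ → I → ℝ) (z : I) (i k j : ℕ) : I → ℝ :=
  leftLiftAux w z j (k - i) i

/-- `ν(f)` exists in the extended sense: `ν(f_+)` or `ν(f_-)` is finite. -/
def ExtIntegrable {I : Set ℝ} (ν : Measure I) (f : I → ℝ) : Prop :=
  ∫⁻ x, ENNReal.ofReal (f x) ∂ν < ∞ ∨ ∫⁻ x, ENNReal.ofReal (-f x) ∂ν < ∞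

/-- `ν(f) = ν(f_+) - ν(f_-)`, an extended real; meaningful when `ExtIntegrable ν f`. -/
def extIntegral {I : Set ℝ} (ν : Measure I) (f : I → ℝ) : EReal :=
  ((∫⁻ x, ENNReal.ofReal (f x) ∂ν : ℝ≥0∞) : EReal) -
    ((∫⁻ x, ENNReal.ofReal (-f x) ∂ν : ℝ≥0∞) : EReal)

/-- `ν₁(f) ≥ ν₂(f)`, including the existence of both integrals. -/
def ExtIntegralGE {I : Set ℝ} (ν₁ ν₂ : Measure I) (f : I → ℝ) : Prop :=
  ExtIntegrable ν₁ f ∧ ExtIntegrable ν₂ f ∧ extIntegral ν₁ f ≥ extIntegral ν₂ f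

/-- `ν₁(f) = ν₂(f) ∈ ℝ`, including the existence of both integrals. -/
def ExtIntegralEqReal {I : Set ℝ} (ν₁ ν₂ : Measure I) (f : I → ℝ) : Prop :=
  ExtIntegrable ν₁ f ∧ ExtIntegrable ν₂ f ∧
    ∃ r : ℝ, extIntegral ν₁ f = (r : EReal) ∧ extIntegral ν₂ f = (r : EReal)

/-- The admissible set `N_+(G)`: the nonnegative Borel measures on `I` with `ν(f) > -∞` for all
`f ∈ G`. -/
def admissible {I : Set ℝ} (G : Set (I → ℝ)) : Set (Measure I) :=
  {ν | ∀ f ∈ G, ExtIntegrable ν f ∧ ⊥ < extIntegral ν f}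

/-- The dual cone of `G`: the pairs of admissible measures with `ν₁(f) ≥ ν₂(f)` for `f ∈ G`. -/
def dualCone {I : Set ℝ} (G : Set (I → ℝ)) : Set (Measure I × Measure I) :=
  {ν | ν.1 ∈ admissible G ∧ ν.2 ∈ admissible G ∧ ∀ f ∈ G, ExtIntegralGE ν.1 ν.2 f}

theorem extendZero_coe {β : Type} [Zero β] {I : Set ℝ} (f : I → β) (x : I) :
    extendZero f (x : ℝ) = f x := by
  simp [extendZero]

/-- The generalized derivative is uniquely determined, so that `genDeriv` is well defined. -/
theorem IsGenDeriv.unique {I : Set ℝ} (hI : I.OrdConnected) (hI' : I.Nontrivial) {w f g₁ g₂ : I → ℝ}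
    (hw : ∀ x, 0 < w x) (h₁ : IsGenDeriv w f g₁) (h₂ : IsGenDeriv w f g₂) : g₁ = g₂ := by
  obtain ⟨-, -, hL₁, hi₁⟩ := h₁
  obtain ⟨-, -, hL₂, hi₂⟩ := h₂
  set q : I → ℝ := fun x => g₁ x / w x - g₂ x / w x with hq
  have hmem : ∀ {x y : I} {u : ℝ}, u ∈ Icc (x : ℝ) y → u ∈ I := fun {x y u} hu =>
    hI.out x.2 y.2 hu
  have key : ∀ x : I, ¬ IsTop x → ∀ c : ℝ, (c = 1 ∨ c = -1) → ¬ 0 < c * q x := by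
    intro x hx c hc hpos
    have hcont : ContinuousWithinAt (fun y => c * q y) (Ici x) x :=
      continuousWithinAt_const.mul ((hL₁.1 x hx).sub (hL₂.1 x hx))
    have hev := hcont.eventually (lt_mem_nhds hpos)
    obtain ⟨y, hxy⟩ : ∃ y : I, x < y := by simpa [IsTop] using hx
    rw [eventually_nhdsWithin_iff, Metric.eventually_nhds_iff] at hev
    obtain ⟨ε, hε, hev⟩ := hev
    set v : ℝ := min (y : ℝ) (x + ε / 2) with hv
    have hxv : (x : ℝ) < v := lt_min hxy (by linarith)
    have hvI : v ∈ I := hI.out x.2 y.2 ⟨hxv.le, min_le_left _ _⟩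
    have e₁ := hi₁ ⟨v, hvI⟩ x
    have e₂ := hi₂ ⟨v, hvI⟩ x
    have hpi : 0 < ∫ u in (x : ℝ)..v, c * (extendZero g₁ u - extendZero g₂ u) := by
      refine intervalIntegral.intervalIntegral_pos_of_pos_on
        ((e₁.1.sub e₂.1).const_mul c) (fun u hu => ?_) hxv
      have huI : u ∈ I := hI.out x.2 hvI ⟨hu.1.le, hu.2.le⟩
      have h := hev (y := ⟨u, huI⟩) (by
        rw [Subtype.dist_eq, Real.dist_eq, abs_of_pos (by simpa using hu.1)]
        have : u < x + ε / 2 := lt_of_lt_of_le hu.2 (min_le_right _ _)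
        simp only
        linarith) (show x ≤ ⟨u, huI⟩ from hu.1.le)
      rw [extendZero_coe g₁ ⟨u, huI⟩, extendZero_coe g₂ ⟨u, huI⟩]
      have hwu := hw ⟨u, huI⟩
      have : c * (g₁ ⟨u, huI⟩ - g₂ ⟨u, huI⟩) = (c * q ⟨u, huI⟩) * w ⟨u, huI⟩ := by
        simp only [hq]
        field_simp
      rw [this]
      exact mul_pos h hwu
    rw [intervalIntegral.integral_const_mul, intervalIntegral.integral_sub e₁.1 e₂.1] at hpi
    have : (∫ u in (x : ℝ)..v, extendZero g₁ u) = ∫ u in (x : ℝ)..v, extendZero g₂ u := by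
      have h1 := e₁.2
      have h2 := e₂.2
      simp only at h1 h2
      linarith
    rw [this] at hpi
    simp at hpi
  have hnt : ∀ x : I, ¬ IsTop x → q x = 0 := by
    intro x hx
    have h1 := key x hx 1 (Or.inl rfl)
    have h2 := key x hx (-1) (Or.inr rfl)
    linarith
  have hall : ∀ x, q x = 0 := by
    intro x
    by_cases hx : IsTop x
    · have hcont : ContinuousWithinAt q (Iic x) x := (hL₁.2 x hx).sub (hL₂.2 x hx)
      obtain ⟨y, hy⟩ : ∃ y : I, y < x := by
        obtain ⟨y, hyI, hne⟩ := hI'.exists_ne (x : ℝ)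
        exact ⟨⟨y, hyI⟩, lt_of_le_of_ne (hx _) (fun h => hne (congrArg Subtype.val h))⟩
      have hne : (nhdsWithin x (Iio x)).NeBot := by
        rw [← mem_closure_iff_nhdsWithin_neBot, Metric.mem_closure_iff]
        intro ε hε
        have hlt : max (y : ℝ) (x - ε / 2) < x := max_lt hy (by linarith)
        refine ⟨⟨max (y : ℝ) (x - ε / 2), hI.out y.2 x.2 ⟨le_max_left _ _, hlt.le⟩⟩, hlt, ?_⟩
        rw [Subtype.dist_eq, Real.dist_eq, abs_of_pos (by simpa using hlt)]
        have : (x : ℝ) - ε / 2 ≤ max (y : ℝ) (x - ε / 2) := le_max_right _ _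
        simp only
        linarith
      have ht := hcont.mono Iio_subset_Iic_self
      have h0 : Filter.Tendsto q (nhdsWithin x (Iio x)) (nhds 0) := by
        refine tendsto_const_nhds.congr' ?_
        filter_upwards [self_mem_nhdsWithin] with u hu
        exact (hnt u (fun h => absurd (h x) (not_le.mpr hu))).symm
      exact tendsto_nhds_unique ht h0
    · exact hnt x hx
  funext x
  have h := hall x
  have hwx := (hw x).ne'
  simp only [hq] at h
  field_simp at h
  linarith

end GaugedCone

end

/-!
Let `f⁽ʲ⁾ = gDer w j f`, and write `k = N + 1`.

Necessity is a matter of membership: the functions `± p_{s;0,i}` with `i < k` and the functions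
`p_{a,z;0:k:j}` are `w`-polynomials in the cone.  They are iterated integrals, and their gauged
derivatives are read off from the chain of intermediate integrals by uniqueness of the generalized
derivative (`IsChain.gDer_eq`, `ptPoly_mem_wPolyCone`, `leftLift_mem_wPolyCone`).

For sufficiency, Taylor's formula at `z` (`IsChain.taylor`) writes `f` in the cone as a polynomial
of degree at most `N`, which has the same finite integral for both measures, plus the `N`-fold
iterated integral `h` from `z` of `w_N (f⁽ᴺ⁾ - f⁽ᴺ⁾(z))`.  Since `f⁽ᴺ⁾` is nondecreasing, `h ≥ 0` on
the right of `z` and `(-1)^k h ≥ 0` on the left.  So `ν₁(h) ≥ ν₂(h)` compares the integrals of `|h|`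
against two nonnegative measures, assembled from the restrictions of `ν₁` and `ν₂` to the sets where
`h` has constant sign (`IsChain.extIntegralGE_iff`); no subtraction remains.  On functions with such
a sign pattern, `g ↦ |w_i ∫_z g|` is integration of `|g|` against a kernel, so the comparison can be
transposed, by composing measures with kernels, to the derivative of order `N` or `N + 1`.

* If `k ≤ n`, the derivatives of orders `k, …, n` are nonnegative, and expansion at the left endpoint
  (`IsChain.left_expansion`) gives `w_k f⁽ᵏ⁾ = ∑_{j=k}^n c_j p_{a;k,j} + R`, with `c_j ≥ 0` the limit
  of `f⁽ʲ⁾` at `a`, and `R` an iterated integral from `a` of `w_n (f⁽ⁿ⁾ - c_n)`.  If `c_j > 0`, then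
  `p_{a;k,j}` is finite, so that the hypothesis on `p_{a,z;0:k:j}` applies.  The term `R` is
  transposed once more; what is then to be compared are the integrals of the nondecreasing function
  `f⁽ⁿ⁾ - c_n ≥ 0` against two measures, and by the layer cake formula it is enough to compare the
  measures of up-sets, hence of the half-lines `[t, ∞)`.  This is the hypothesis on `p⁺_{t;0,n}`.
* If `k = n + 1`, one compares the integrals of `|f⁽ⁿ⁾ - f⁽ⁿ⁾(z)|`, whose superlevel sets consist of
  an up-set on the right of `z` and a down-set on its left.  The functions `p⁺_{t;0,n}` control
  `[t, ∞)` for `t > z` and `(-∞, t)` for `t ≤ z`.  A down-set is a decreasing limit of such half-lines,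
  and the measures are finite because `p_{z;0,n}` is integrable.
-/

namespace GaugedCone
open ProbabilityTheory Filter Topology

/-! ### Integration over subintervals of `I` -/

section Integration

variable {I : Set ℝ}

/-- Lebesgue measure on `I`. -/
noncomputable def lebesgue (I : Set ℝ) : Measure I := Measure.comap Subtype.val volume

instance [hI : I.OrdConnected] : IsLocallyFiniteMeasure (lebesgue I) := by
  refine ⟨fun x => ⟨Subtype.val ⁻¹' Metric.ball (x : ℝ) 1, ?_, ?_⟩⟩
  · exact (Metric.isOpen_ball.preimage continuous_subtype_val).mem_nhds
      (Metric.mem_ball_self one_pos)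
  · rw [lebesgue, comap_subtype_coe_apply hI.measurableSet]
    exact (measure_mono (image_preimage_subset _ _)).trans_lt measure_ball_lt_top

theorem setLIntegral_extendZero [hI : I.OrdConnected] (φ : I → ℝ≥0∞) {s : Set ℝ}
    (hs : MeasurableSet s) :
    ∫⁻ u in s, extendZero φ u = ∫⁻ v in Subtype.val ⁻¹' s, φ v ∂lebesgue I := by
  have h1 := setLIntegral_subtype (μ := volume) hI.measurableSet (Subtype.val ⁻¹' s)
    (extendZero φ)
  simp only [extendZero_coe] at h1
  rw [lebesgue, h1, Subtype.image_preimage_coe, inter_comm]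
  rw [← lintegral_indicator hs, ← lintegral_indicator (hs.inter hI.measurableSet)]
  congr 1
  funext u
  by_cases hu : u ∈ I <;> by_cases hs : u ∈ s <;> simp [indicator, hu, hs, extendZero]

/-- A Borel function on `I` which is bounded on every compact subinterval of `I`. -/
structure LocBdd (g : I → ℝ) : Prop where
  measurable : Measurable g
  bdd : ∀ x y : I, ∃ C, ∀ u ∈ Icc x y, |g u| ≤ C

theorem isCompact_Icc_subtype [hI : I.OrdConnected] (x y : I) : IsCompact (Icc x y) := by
  rw [Subtype.isCompact_iff]
  convert isCompact_Icc (a := (x : ℝ)) (b := y)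
  ext u
  constructor
  · rintro ⟨v, hv, rfl⟩
    exact hv
  · intro hu
    exact ⟨⟨u, hI.out x.2 y.2 hu⟩, hu, rfl⟩

theorem LocBdd.mul {f g : I → ℝ} (hf : LocBdd f) (hg : LocBdd g) :
    LocBdd (fun x => f x * g x) := by
  refine ⟨hf.1.mul hg.1, fun x y => ?_⟩
  obtain ⟨C, hC⟩ := hf.2 x y
  obtain ⟨D, hD⟩ := hg.2 x y
  refine ⟨C * D, fun u hu => ?_⟩
  rw [abs_mul]
  exact mul_le_mul (hC u hu) (hD u hu) (abs_nonneg _) ((abs_nonneg _).trans (hC u hu))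

theorem LocBdd.const (c : ℝ) : LocBdd (fun _ : I => c) :=
  ⟨measurable_const, fun _ _ => ⟨|c|, fun _ _ => le_rfl⟩⟩

theorem LocBdd.sub {f g : I → ℝ} (hf : LocBdd f) (hg : LocBdd g) :
    LocBdd (fun x => f x - g x) := by
  refine ⟨hf.1.sub hg.1, fun x y => ?_⟩
  obtain ⟨C, hC⟩ := hf.2 x y
  obtain ⟨D, hD⟩ := hg.2 x y
  exact ⟨C + D, fun u hu => (abs_sub _ _).trans (add_le_add (hC u hu) (hD u hu))⟩

theorem LocBdd.neg {f : I → ℝ} (hf : LocBdd f) : LocBdd (fun x => -f x) :=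
  ⟨hf.1.neg, fun x y => (hf.2 x y).imp fun C hC u hu => by rw [abs_neg]; exact hC u hu⟩

theorem LocBdd.of_monotone [I.OrdConnected] {g : I → ℝ} (hg : Monotone g) : LocBdd g := by
  refine ⟨hg.measurable, fun x y => ⟨max |g x| |g y|, fun u hu => ?_⟩⟩
  exact abs_le_max_abs_abs (hg hu.1) (hg hu.2)

theorem LocBdd.of_continuous [I.OrdConnected] {g : I → ℝ} (hg : Continuous g) : LocBdd g := by
  refine ⟨hg.measurable, fun x y => ?_⟩
  obtain ⟨C, hC⟩ := (isCompact_Icc_subtype x y).exists_bound_of_continuousOn hg.continuousOn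
  exact ⟨C, hC⟩

theorem IsGauge.locBdd [I.OrdConnected] {w : ℕ → I → ℝ} (hw : IsGauge w) (i : ℕ) :
    LocBdd (w i) := by
  refine ⟨hw.measurable i, fun x y => ?_⟩
  obtain ⟨C, hC⟩ := hw.locallyBounded i _ (isCompact_Icc_subtype x y)
  exact ⟨C, fun u hu => by rw [abs_of_pos (hw.pos i u)]; exact hC u hu⟩

theorem measurable_extendZero [hI : I.OrdConnected] {g : I → ℝ} (hg : Measurable g) :
    Measurable (extendZero g) := by
  unfold extendZero
  classical
  convert Measurable.dite (s := I) hg measurable_const hI.measurableSet using 3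

theorem LocBdd.intervalIntegrable [hI : I.OrdConnected] {g : I → ℝ} (hg : LocBdd g) (x y : I) :
    IntervalIntegrable (extendZero g) volume x y := by
  wlog hxy : x ≤ y generalizing x y
  · exact (this y x (le_of_not_ge hxy)).symm
  rw [intervalIntegrable_iff_integrableOn_Ioc_of_le hxy]
  obtain ⟨C, hC⟩ := hg.2 x y
  refine Measure.integrableOn_of_bounded (M := C) (by simp)
    (measurable_extendZero hg.1).aestronglyMeasurable ?_
  refine (ae_restrict_iff' measurableSet_Ioc).2 (Eventually.of_forall fun u hu => ?_)
  have hu' : u ∈ I := hI.out x.2 y.2 ⟨hu.1.le, hu.2⟩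
  rw [show extendZero g u = g ⟨u, hu'⟩ from extendZero_coe g ⟨u, hu'⟩]
  exact hC ⟨u, hu'⟩ ⟨hu.1.le, hu.2⟩

theorem abs_integral_le [hI : I.OrdConnected] {g : I → ℝ} {x y : I} {C : ℝ}
    (hC : ∀ u ∈ uIcc x y, |g u| ≤ C) :
    |∫ u in (x : ℝ)..y, extendZero g u| ≤ C * |(y : ℝ) - x| := by
  refine intervalIntegral.norm_integral_le_of_norm_le_const (E := ℝ) fun u hu => ?_
  have hu2 : u ∈ uIcc (x : ℝ) y := uIoc_subset_uIcc hu
  have hu' : u ∈ I := hI.uIcc_subset x.2 y.2 hu2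
  rw [show extendZero g u = g ⟨u, hu'⟩ from extendZero_coe g ⟨u, hu'⟩]
  refine hC ⟨u, hu'⟩ ?_
  rw [mem_uIcc] at hu2 ⊢
  exact hu2

/-- A function with a locally bounded density is continuous. -/
theorem continuous_of_sub_eq_integral [hI : I.OrdConnected] {F g : I → ℝ} (hg : LocBdd g)
    (hF : ∀ x y : I, F x - F y = ∫ u in (y : ℝ)..x, extendZero g u) : Continuous F := by
  rw [continuous_iff_continuousAt]
  intro x
  obtain ⟨c, d, hx, hcd, -⟩ := exists_Icc_mem_subset_of_mem_nhds (univ_mem (f := 𝓝 x))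
  obtain ⟨C, hC⟩ := hg.2 c d
  rw [ContinuousAt, tendsto_iff_dist_tendsto_zero]
  have hlim : Tendsto (fun y : I => C * |(y : ℝ) - x|) (𝓝 x) (𝓝 0) := by
    have : Continuous (fun y : I => C * |(y : ℝ) - x|) := by fun_prop
    simpa using this.tendsto x
  refine squeeze_zero' (Eventually.of_forall fun _ => dist_nonneg) ?_ hlim
  filter_upwards [hcd] with y hy
  rw [Real.dist_eq, hF]
  exact abs_integral_le fun u hu => hC u (uIcc_subset_Icc hx hy hu)

theorem continuous_integral [I.OrdConnected] {g : I → ℝ} (hg : LocBdd g) (z : I) :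
    Continuous (fun x : I => ∫ u in (z : ℝ)..x, extendZero g u) := by
  refine continuous_of_sub_eq_integral hg fun x y => ?_
  exact intervalIntegral.integral_interval_sub_left (hg.intervalIntegrable z x)
    (hg.intervalIntegrable z y)

theorem integral_extendZero_congr [hI : I.OrdConnected] {f g : I → ℝ} {x y : I}
    (h : ∀ u ∈ uIcc x y, f u = g u) :
    ∫ u in (x : ℝ)..y, extendZero f u = ∫ u in (x : ℝ)..y, extendZero g u := by
  refine intervalIntegral.integral_congr fun u hu => ?_
  have hu' : u ∈ I := hI.uIcc_subset x.2 y.2 hu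
  have := h ⟨u, hu'⟩ (by rw [mem_uIcc] at hu ⊢; exact hu)
  simp [extendZero, hu', this]

theorem integral_extendZero_nonneg [hI : I.OrdConnected] {g : I → ℝ} {x y : I} (hxy : x ≤ y)
    (h : ∀ u ∈ Icc x y, 0 ≤ g u) : 0 ≤ ∫ u in (x : ℝ)..y, extendZero g u := by
  refine intervalIntegral.integral_nonneg hxy fun u hu => ?_
  have hu' : u ∈ I := hI.out x.2 y.2 hu
  simpa [extendZero, hu'] using h ⟨u, hu'⟩ hu

theorem enorm_integral_of_nonneg [hI : I.OrdConnected] {g : I → ℝ} {x y : I} (hg : LocBdd g)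
    (h : ∀ u ∈ uIcc x y, 0 ≤ g u) :
    ‖∫ u in (x : ℝ)..y, extendZero g u‖ₑ = ∫⁻ v in uIoc x y, ‖g v‖ₑ ∂lebesgue I := by
  have hpre : uIoc x y = Subtype.val ⁻¹' (uIoc (x : ℝ) y) := by
    ext u
    simp only [mem_preimage, mem_uIoc, Subtype.coe_lt_coe, Subtype.coe_le_coe]
  have hen : ∀ u, ‖extendZero g u‖ₑ = extendZero (fun v => ‖g v‖ₑ) u := by
    intro u
    by_cases hu : u ∈ I <;> simp [extendZero, hu]
  rw [hpre, ← setLIntegral_extendZero _ measurableSet_uIoc]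
  have hint := (intervalIntegrable_iff.1 (hg.intervalIntegrable x y))
  rw [← lintegral_congr hen, ← ofReal_integral_norm_eq_lintegral_enorm hint,
    ← ofReal_norm, intervalIntegral.norm_intervalIntegral_eq]
  congr 1
  rw [Real.norm_of_nonneg]
  · refine setIntegral_congr_fun measurableSet_uIoc fun u hu => ?_
    have hu2 := uIoc_subset_uIcc hu
    have hu' : u ∈ I := hI.uIcc_subset x.2 y.2 hu2
    have := h ⟨u, hu'⟩ (by rw [mem_uIcc] at hu2 ⊢; exact hu2)
    simp [extendZero, hu', abs_of_nonneg this]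
  · refine setIntegral_nonneg measurableSet_uIoc fun u hu => ?_
    have hu2 := uIoc_subset_uIcc hu
    have hu' : u ∈ I := hI.uIcc_subset x.2 y.2 hu2
    have := h ⟨u, hu'⟩ (by rw [mem_uIcc] at hu2 ⊢; exact hu2)
    simpa [extendZero, hu'] using this

theorem extendZero_neg (g : I → ℝ) (u : ℝ) : extendZero (fun x => -g x) u = -extendZero g u := by
  by_cases hu : u ∈ I <;> simp [extendZero, hu]

theorem integral_extendZero_neg (g : I → ℝ) (x y : ℝ) :
    ∫ u in x..y, extendZero (fun x => -g x) u = -∫ u in x..y, extendZero g u := by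
  simp only [extendZero_neg, intervalIntegral.integral_neg]

theorem enorm_integral_of_nonpos [hI : I.OrdConnected] {g : I → ℝ} {x y : I} (hg : LocBdd g)
    (h : ∀ u ∈ uIcc x y, g u ≤ 0) :
    ‖∫ u in (x : ℝ)..y, extendZero g u‖ₑ = ∫⁻ v in uIoc x y, ‖g v‖ₑ ∂lebesgue I := by
  have := enorm_integral_of_nonneg hg.neg (x := x) (y := y) fun u hu => by linarith [h u hu]
  simpa only [enorm_neg, integral_extendZero_neg] using this

end Integration

/-! ### Iterated integrals and kernels -/

section Lift

variable {I : Set ℝ} {w : ℕ → I → ℝ} {z : I}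

/-- The iterated integral `w_i ∫_z (w_{i+1} ∫_z (⋯ w_{i+e-1} ∫_z g))`, with `e` integrations. -/
noncomputable def lift (w : ℕ → I → ℝ) (z : I) : ℕ → ℕ → (I → ℝ) → I → ℝ
  | 0, _, g => g
  | e + 1, i, g => fun x => w i x * ∫ u in (z : ℝ)..x, extendZero (lift w z e (i + 1) g) u

theorem ptPolyAux_eq_lift (w : ℕ → I → ℝ) (t : I) (d j : ℕ) :
    ptPolyAux w t d j = lift w t d j (w (j + d)) := by
  induction d generalizing j with
  | zero => rfl
  | succ d ih => simp only [ptPolyAux, lift, ih, Nat.add_right_comm j 1 d, Nat.add_assoc]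

theorem leftLiftAux_eq_lift (w : ℕ → I → ℝ) (z : I) (j e i : ℕ) :
    leftLiftAux w z j e i = lift w z e i (fun x => (leftPoly w (i + e) j x).toReal) := by
  induction e generalizing i with
  | zero => rfl
  | succ e ih => simp only [leftLiftAux, lift, ih, Nat.add_right_comm i 1 e, Nat.add_assoc]

theorem lift_succ_eq_lift (w : ℕ → I → ℝ) (z : I) (e i : ℕ) (g : I → ℝ) :
    lift w z (e + 1) i g =
      lift w z e i (fun x => w (i + e) x * ∫ u in (z : ℝ)..x, extendZero g u) := by
  induction e generalizing i with
  | zero => rfl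
  | succ e ih =>
    rw [lift, ih (i + 1), Nat.add_right_comm i 1 e]
    rfl

theorem lift_zero_fun (w : ℕ → I → ℝ) (z : I) (e i : ℕ) :
    lift w z e i (fun _ => 0) = fun _ => 0 := by
  induction e generalizing i with
  | zero => rfl
  | succ e ih =>
    funext x
    have : extendZero (fun _ : I => (0 : ℝ)) = fun _ => 0 := by
      funext u
      simp [extendZero]
    simp [lift, ih, this]

theorem LocBdd.lift_step [I.OrdConnected] (hw : IsGauge w) {g : I → ℝ} (hg : LocBdd g) (z : I)
    (i : ℕ) : LocBdd (fun x => w i x * ∫ u in (z : ℝ)..x, extendZero g u) :=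
  (hw.locBdd i).mul (.of_continuous (continuous_integral hg z))

theorem LocBdd.lift [I.OrdConnected] (hw : IsGauge w) {g : I → ℝ} (hg : LocBdd g) (z : I)
    (e i : ℕ) : LocBdd (lift w z e i g) := by
  induction e generalizing i with
  | zero => exact hg
  | succ e ih => exact (ih (i + 1)).lift_step hw z i

/-- The function `g` is nonnegative on the right of `z`, and `(-1)^m g` is nonnegative on the left
of `z` (so that `g z = 0` when `m` is odd). -/
def SignPattern (z : I) (m : ℕ) (g : I → ℝ) : Prop :=
  ∀ x, (z ≤ x → 0 ≤ g x) ∧ (x ≤ z → 0 ≤ (-1) ^ m * g x)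

theorem SignPattern.mul_left {m : ℕ} {g v : I → ℝ} (hg : SignPattern z m g) (hv : ∀ x, 0 < v x) :
    SignPattern z m (fun x => v x * g x) := by
  refine fun x => ⟨fun h => mul_nonneg (hv x).le ((hg x).1 h), fun h => ?_⟩
  rw [mul_left_comm]
  exact mul_nonneg (hv x).le ((hg x).2 h)

theorem SignPattern.enorm_integral [I.OrdConnected] {m : ℕ} {g : I → ℝ} (hg : SignPattern z m g)
    (hb : LocBdd g) (x : I) :
    ‖∫ u in (z : ℝ)..x, extendZero g u‖ₑ = ∫⁻ v in uIoc z x, ‖g v‖ₑ ∂lebesgue I := by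
  rcases le_total z x with h | h
  · refine enorm_integral_of_nonneg hb fun u hu => (hg u).1 ?_
    rw [uIcc_of_le h] at hu
    exact hu.1
  · rcases Nat.even_or_odd m with hm | hm
    · refine enorm_integral_of_nonneg hb fun u hu => ?_
      rw [uIcc_of_ge h] at hu
      simpa [hm.neg_one_pow] using (hg u).2 hu.2
    · refine enorm_integral_of_nonpos hb fun u hu => ?_
      rw [uIcc_of_ge h] at hu
      simpa [hm.neg_one_pow] using (hg u).2 hu.2

/-- Integration from `z` shifts the sign pattern by one. -/
theorem SignPattern.integral [I.OrdConnected] {m : ℕ} {g : I → ℝ} (hg : SignPattern z m g) :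
    SignPattern z (m + 1) (fun x => ∫ u in (z : ℝ)..x, extendZero g u) := by
  refine fun x => ⟨fun h => ?_, fun h => ?_⟩
  · exact integral_extendZero_nonneg h fun u hu => (hg u).1 hu.1
  · beta_reduce
    rw [intervalIntegral.integral_symm, pow_succ, mul_assoc, mul_neg, neg_mul, one_mul, neg_neg]
    rcases Nat.even_or_odd m with hm | hm
    · rw [hm.neg_one_pow, one_mul]
      refine integral_extendZero_nonneg h fun u hu => ?_
      simpa [hm.neg_one_pow] using (hg u).2 hu.2
    · rw [hm.neg_one_pow, neg_one_mul, ← integral_extendZero_neg]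
      refine integral_extendZero_nonneg h fun u hu => ?_
      simpa [hm.neg_one_pow] using (hg u).2 hu.2

theorem SignPattern.lift [I.OrdConnected] {m : ℕ} {g : I → ℝ} (hw : IsGauge w)
    (hg : SignPattern z m g) (e i : ℕ) : SignPattern z (m + e) (lift w z e i g) := by
  induction e generalizing i with
  | zero => exact hg
  | succ e ih => exact (ih (i + 1)).integral.mul_left (hw.pos i)

theorem SignPattern.of_nonneg {g : I → ℝ} (hg : ∀ x, 0 ≤ g x) (z : I) : SignPattern z 0 g :=
  fun x => ⟨fun _ => hg x, fun _ => by simpa using hg x⟩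

theorem SignPattern.of_monotone {g : I → ℝ} (hg : Monotone g) (z : I) :
    SignPattern z 1 (fun x => g x - g z) :=
  fun _ => ⟨fun h => sub_nonneg.2 (hg h), fun h => by simpa using hg h⟩

/-- The kernel `x ↦ v(x) · (Lebesgue measure restricted to s(x))`. -/
noncomputable def weightedKernel [I.OrdConnected] (v : I → ℝ) (s : I → Set I) : Kernel I I :=
  (Kernel.const I (lebesgue I)).withDensity
    (fun x u => ENNReal.ofReal (v x) * (s x).indicator 1 u)

theorem lintegral_weightedKernel [I.OrdConnected] {v : I → ℝ} {s : I → Set I} (hv : Measurable v)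
    (hs : MeasurableSet {p : I × I | p.2 ∈ s p.1}) {φ : I → ℝ≥0∞} (hφ : Measurable φ) (x : I) :
    ∫⁻ u, φ u ∂weightedKernel v s x = ENNReal.ofReal (v x) * ∫⁻ u in s x, φ u ∂lebesgue I := by
  have hsx : MeasurableSet (s x) := measurable_prodMk_left hs
  have hm : Measurable (Function.uncurry fun x u =>
      ENNReal.ofReal (v x) * (s x).indicator (1 : I → ℝ≥0∞) u) := by
    refine (ENNReal.measurable_ofReal.comp (hv.comp measurable_fst)).mul ?_
    exact (measurable_const (a := (1 : ℝ≥0∞))).indicator hs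
  rw [weightedKernel, Kernel.lintegral_withDensity _ hm _ hφ, Kernel.const_apply]
  simp only [mul_assoc]
  rw [lintegral_const_mul' _ _ ENNReal.ofReal_ne_top, ← lintegral_indicator hsx]
  congr 2
  funext u
  by_cases hu : u ∈ s x <;> simp [hu]

/-- The composition `κ_{i+e-1} ∘ ⋯ ∘ κ_i` of `e` consecutive members of a family of kernels. -/
noncomputable def iterKernel (κ : ℕ → Kernel I I) : ℕ → ℕ → Kernel I I
  | 0, _ => Kernel.id
  | e + 1, i => iterKernel κ e (i + 1) ∘ₖ κ i

theorem lintegral_iterKernel_zero (κ : ℕ → Kernel I I) (i : ℕ) {φ : I → ℝ≥0∞} (hφ : Measurable φ)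
    (x : I) : ∫⁻ u, φ u ∂iterKernel κ 0 i x = φ x := by
  rw [iterKernel, Kernel.id_apply, lintegral_dirac' _ hφ]

theorem lintegral_iterKernel_succ (κ : ℕ → Kernel I I) (e i : ℕ) {φ : I → ℝ≥0∞}
    (hφ : Measurable φ) (x : I) :
    ∫⁻ u, φ u ∂iterKernel κ (e + 1) i x =
      ∫⁻ v, ∫⁻ u, φ u ∂iterKernel κ e (i + 1) v ∂κ i x := by
  rw [iterKernel, Kernel.lintegral_comp _ _ _ hφ]

/-- The kernel of the operator `g ↦ |w_i ∫_z g|` on functions of constant sign on either side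
of `z`. -/
noncomputable def liftKernel [I.OrdConnected] (w : ℕ → I → ℝ) (z : I) (i : ℕ) : Kernel I I :=
  weightedKernel (w i) (fun x => uIoc z x)

/-- The kernel of the operator `g ↦ w_i ∫_a g`, where `a` is the left endpoint of `I`. -/
noncomputable def leftKernel [I.OrdConnected] (w : ℕ → I → ℝ) (i : ℕ) : Kernel I I :=
  weightedKernel (w i) (fun x => Iio x)

theorem lintegral_liftKernel [I.OrdConnected] (hw : IsGauge w) (z : I) (i : ℕ) {φ : I → ℝ≥0∞}
    (hφ : Measurable φ) (x : I) : ∫⁻ u, φ u ∂liftKernel w z i x =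
      ENNReal.ofReal (w i x) * ∫⁻ u in uIoc z x, φ u ∂lebesgue I := by
  refine lintegral_weightedKernel (s := fun x => uIoc z x) (hw.measurable i) ?_ hφ x
  have h : {p : I × I | p.2 ∈ uIoc z p.1} =
      {p | z < p.2} ∩ {p | p.2 ≤ p.1} ∪ {p | p.1 < p.2} ∩ {p | p.2 ≤ z} := by
    ext p
    simp only [mem_ofPred_eq, mem_uIoc, mem_union, mem_inter_iff]
  rw [h]
  exact ((measurableSet_lt measurable_const measurable_snd).inter
      (measurableSet_le measurable_snd measurable_fst)).union
    ((measurableSet_lt measurable_fst measurable_snd).inter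
      (measurableSet_le measurable_snd measurable_const))

theorem lintegral_leftKernel [I.OrdConnected] (hw : IsGauge w) (i : ℕ) {φ : I → ℝ≥0∞}
    (hφ : Measurable φ) (x : I) : ∫⁻ u, φ u ∂leftKernel w i x =
      ENNReal.ofReal (w i x) * ∫⁻ u in Iio x, φ u ∂lebesgue I :=
  lintegral_weightedKernel (s := fun x => Iio x) (hw.measurable i)
    (measurableSet_lt measurable_snd measurable_fst) hφ x

/-- On functions with a sign pattern, the absolute value of an iterated integral is linear in the
absolute value of the integrand. -/
theorem SignPattern.enorm_lift [I.OrdConnected] {m : ℕ} {g : I → ℝ} (hw : IsGauge w)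
    (hg : SignPattern z m g) (hb : LocBdd g) (e i : ℕ) (x : I) :
    ‖GaugedCone.lift w z e i g x‖ₑ = ∫⁻ u, ‖g u‖ₑ ∂iterKernel (liftKernel w z) e i x := by
  induction e generalizing i x with
  | zero => rw [lintegral_iterKernel_zero _ _ hb.1.enorm]; rfl
  | succ e ih =>
    rw [lintegral_iterKernel_succ _ _ _ hb.1.enorm]
    simp only [← ih]
    rw [lintegral_liftKernel hw _ _ (hb.lift hw z e (i + 1)).1.enorm,
      ← (hg.lift hw e (i + 1)).enorm_integral (hb.lift hw z e (i + 1))]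
    simp only [GaugedCone.lift]
    rw [enorm_mul, Real.enorm_of_nonneg (hw.pos i x).le]

theorem leftPolyAux_eq_lintegral [I.OrdConnected] (hw : IsGauge w) (d j : ℕ) (x : I) :
    leftPolyAux w d j x =
      ∫⁻ u, ENNReal.ofReal (w (j + d) u) ∂iterKernel (leftKernel w) d j x := by
  have hm (i : ℕ) : Measurable (fun u => ENNReal.ofReal (w i u)) :=
    (hw.measurable i).ennreal_ofReal
  induction d generalizing j x with
  | zero => rw [lintegral_iterKernel_zero _ _ (hm _)]; rfl
  | succ d ih =>
    rw [lintegral_iterKernel_succ _ _ _ (hm _), lintegral_leftKernel hw _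
      (hm _).lintegral_kernel, leftPolyAux]
    beta_reduce
    rw [setLIntegral_extendZero _ measurableSet_Iio]
    simp only [ih, Nat.add_right_comm j 1 d, Nat.add_assoc]
    rfl

theorem leftPoly_eq_lintegral [I.OrdConnected] (hw : IsGauge w) {j m : ℕ} (hjm : j ≤ m) (x : I) :
    leftPoly w j m x =
      ∫⁻ u, ENNReal.ofReal (w m u) ∂iterKernel (leftKernel w) (m - j) j x := by
  rw [leftPoly, leftPolyAux_eq_lintegral hw, Nat.add_sub_cancel' hjm]

theorem leftPoly_self (w : ℕ → I → ℝ) (m : ℕ) (x : I) :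
    leftPoly w m m x = ENNReal.ofReal (w m x) := by
  rw [leftPoly, Nat.sub_self]
  rfl

theorem leftPoly_of_lt [I.OrdConnected] (w : ℕ → I → ℝ) {j m : ℕ} (hjm : j < m) (x : I) :
    leftPoly w j m x =
      ENNReal.ofReal (w j x) * ∫⁻ u in Iio x, leftPoly w (j + 1) m u ∂lebesgue I := by
  obtain ⟨d, rfl⟩ := Nat.exists_eq_add_of_lt hjm
  rw [leftPoly, show j + d + 1 - j = d + 1 by omega, leftPolyAux]
  beta_reduce
  rw [setLIntegral_extendZero _ measurableSet_Iio]
  simp only [leftPoly, show j + d + 1 - (j + 1) = d by omega]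
  rfl

theorem measurable_leftPoly [I.OrdConnected] (hw : IsGauge w) {j m : ℕ} (hjm : j ≤ m) :
    Measurable (leftPoly w j m) := by
  rw [show leftPoly w j m = _ from funext (leftPoly_eq_lintegral hw hjm)]
  exact (hw.measurable m).ennreal_ofReal.lintegral_kernel

/-- The truncated polynomial `p^+_{t;j,m}` is an iterated integral of `w_m 1_{[t, ∞)}`. -/
theorem ptPolyPos_eq_lift [I.OrdConnected] (w : ℕ → I → ℝ) (t : I) {j m : ℕ} (hjm : j ≤ m) :
    ptPolyPos w t j m = lift w t (m - j) j ((Ici t).indicator (w m)) := by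
  obtain ⟨d, rfl⟩ := Nat.exists_eq_add_of_le hjm
  rw [Nat.add_sub_cancel_left]
  clear hjm
  suffices h : ∀ x, lift w t d j ((Ici t).indicator (w (j + d))) x =
      if t ≤ x then ptPolyAux w t d j x else 0 by
    funext x
    simp only [h, ptPolyPos, ptPoly, Nat.add_sub_cancel_left]
  induction d generalizing j with
  | zero => intro x; simp [lift, ptPolyAux, indicator]
  | succ d ih =>
    intro x
    simp only [lift, ptPolyAux]
    have ih' := ih (j := j + 1)
    rw [Nat.add_right_comm j 1 d, Nat.add_assoc j d 1] at ih'
    split_ifs with h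
    · congr 1
      refine integral_extendZero_congr fun u hu => ?_
      rw [uIcc_of_le h] at hu
      exact (ih' u).trans (if_pos hu.1)
    · have : ∫ u in (t : ℝ)..x, extendZero
          (lift w t d (j + 1) ((Ici t).indicator (w (j + (d + 1))))) u =
          ∫ u in (t : ℝ)..x, (0 : ℝ) := by
        rw [intervalIntegral.integral_symm, intervalIntegral.integral_symm (x : ℝ)]
        congr 1
        refine intervalIntegral.integral_congr_Ioo_of_le (le_of_not_ge h) fun u hu => ?_
        by_cases hu' : u ∈ I
        · have h2 : ¬ t ≤ ⟨u, hu'⟩ := not_le.2 hu.2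
          simpa [extendZero, hu', h2] using ih' ⟨u, hu'⟩
        · simp [extendZero, hu']
      rw [this]
      simp

end Lift

/-! ### Chains of derivatives and the Taylor formula -/

section Chain

variable {I : Set ℝ} {w : ℕ → I → ℝ} {z : I}

/-- For `i ≤ j < m`, the function `g_j` is an indefinite integral of `w_{j+1} g_{j+1}`: the relation
between the successive gauged derivatives of a function. -/
def IsChain (w : ℕ → I → ℝ) (g : ℕ → I → ℝ) (i m : ℕ) : Prop :=
  ∀ j, i ≤ j → j < m → ∀ x y : I,
    IntervalIntegrable (extendZero fun u => w (j + 1) u * g (j + 1) u) volume y x ∧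
    g j x = g j y + ∫ u in (y : ℝ)..x, extendZero (fun u => w (j + 1) u * g (j + 1) u) u

theorem IsChain.mono {g : ℕ → I → ℝ} {i m i' m' : ℕ} (hg : IsChain w g i m) (hi : i ≤ i')
    (hm : m' ≤ m) : IsChain w g i' m' :=
  fun j hj hjm => hg j (hi.trans hj) (hjm.trans_le hm)

theorem IsChain.neg {g : ℕ → I → ℝ} {i m : ℕ} (hg : IsChain w g i m) :
    IsChain w (fun j x => -g j x) i m := by
  intro j hj hjm x y
  obtain ⟨h1, h2⟩ := hg j hj hjm x y
  have h : (extendZero fun u => w (j + 1) u * -g (j + 1) u) =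
      fun u => -extendZero (fun u => w (j + 1) u * g (j + 1) u) u := by
    funext u
    rw [← extendZero_neg]
    simp only [mul_neg]
  rw [h]
  exact ⟨h1.neg, by
    beta_reduce
    rw [intervalIntegral.integral_neg, h2]
    ring⟩

/-- Taylor's formula at `z`, with the remainder an iterated integral of the increment of the last
member of the chain. -/
theorem IsChain.taylor [I.OrdConnected] (hw : IsGauge w) {g : ℕ → I → ℝ} (e i : ℕ)
    (hg : IsChain w g i (i + e)) (x : I) :
    w i x * g i x = lift w z e i (fun x => w (i + e) x * (g (i + e) x - g (i + e) z)) x +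
      ∑ l ∈ Finset.range (e + 1), g (i + l) z * ptPolyAux w z l i x := by
  induction e generalizing i x with
  | zero => simp [lift, ptPolyAux]; ring
  | succ e ih =>
    have ih' := ih (i + 1) (hg.mono (Nat.le_succ i) (by omega))
    have hpt (l : ℕ) : LocBdd (ptPolyAux w z l (i + 1)) := by
      rw [ptPolyAux_eq_lift]
      exact (hw.locBdd _).lift hw z l (i + 1)
    obtain ⟨h1, h2⟩ := hg i le_rfl (by omega) x z
    have hrem : extendZero (lift w z e (i + 1) (fun x => w (i + 1 + e) x *
        (g (i + 1 + e) x - g (i + 1 + e) z))) =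
        fun u => extendZero (fun u => w (i + 1) u * g (i + 1) u) u -
          ∑ l ∈ Finset.range (e + 1),
            g (i + 1 + l) z * extendZero (ptPolyAux w z l (i + 1)) u := by
      funext u
      by_cases hu : u ∈ I
      · simp only [extendZero, hu, dif_pos, ih']
        ring
      · simp [extendZero, hu]
    rw [Finset.sum_range_succ', h2]
    simp only [lift, ptPolyAux, Nat.add_zero]
    rw [show i + (e + 1) = i + 1 + e by ring, hrem, intervalIntegral.integral_sub h1,
      intervalIntegral.integral_finsetSum]
    · simp only [intervalIntegral.integral_const_mul, mul_sub, Finset.mul_sum]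
      rw [sub_add_eq_add_sub, ← add_assoc, mul_add]
      have : ∀ l, g (i + (l + 1)) z * (w i x * ∫ u in (z : ℝ)..x,
          extendZero (ptPolyAux w z l (i + 1)) u) = w i x * (g (i + 1 + l) z *
          ∫ u in (z : ℝ)..x, extendZero (ptPolyAux w z l (i + 1)) u) := by
        intro l
        rw [show i + (l + 1) = i + 1 + l by ring]
        ring
      simp only [this]
      ring
    · exact fun l _ => ((hpt l).intervalIntegrable z x).const_mul _
    · convert! IntervalIntegrable.sum (Finset.range (e + 1)) fun l _ =>
        ((hpt l).intervalIntegrable z x).const_mul (g (i + 1 + l) z)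
      simp

/-- Each gauged derivative of order less than `n` is an indefinite integral of the next one. -/
theorem isChain_gDer (hw : IsGauge w) {f : I → ℝ} {n : ℕ} (hf : f ∈ gDom w n) :
    IsChain w (fun j => gDer w j f) 0 n ∧ ∀ j < n, gDer w (j + 1) f ∈ LD I := by
  have hmono : ∀ j ≤ n, f ∈ gDom w j := by
    intro j hj
    induction n, hj using Nat.le_induction with
    | base => exact hf
    | succ n _ ih => exact ih hf.1
  have key : ∀ j < n, IsGenDeriv (w (j + 1)) (gDer w j f)
      (fun u => w (j + 1) u * gDer w (j + 1) f u) := by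
    intro j hj
    have h : ∃ g, IsGenDeriv (w (j + 1)) (gDer w j f) g := (hmono (j + 1) hj).2
    convert h.choose_spec using 1
    funext u
    rw [gDer, genDeriv, dif_pos h, mul_div_cancel₀ _ (hw.pos _ u).ne']
  refine ⟨fun j _ hj x y => (key j hj).2.2.2 x y, fun j hj => ?_⟩
  convert (key j hj).2.2.1 using 1
  funext u
  rw [mul_div_cancel_left₀ _ (hw.pos _ u).ne']

theorem mem_LD_of_continuous {g : I → ℝ} (hg : Continuous g) : g ∈ LD I :=
  ⟨fun _ _ => hg.continuousWithinAt, fun _ _ => hg.continuousWithinAt⟩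

/-- The members of a chain of continuous functions are the gauged derivatives of `w_0 g_0`. -/
theorem IsChain.gDer_eq (hI : I.OrdConnected) (hI' : I.Nontrivial) (hw : IsGauge w)
    {g : ℕ → I → ℝ} {m : ℕ} (hg : IsChain w g 0 m) (hc : ∀ j ≤ m, Continuous (g j)) {j : ℕ}
    (hj : j ≤ m) :
    (fun x => w 0 x * g 0 x) ∈ gDom w j ∧ gDer w j (fun x => w 0 x * g 0 x) = g j := by
  induction j with
  | zero =>
    refine ⟨(hw.measurable 0).mul (hc 0 hj).measurable, ?_⟩
    funext x
    exact mul_div_cancel_left₀ _ (hw.pos 0 x).ne'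
  | succ j ih =>
    obtain ⟨ih1, ih2⟩ := ih (by omega)
    have hdiv : (fun x => w (j + 1) x * g (j + 1) x / w (j + 1) x) = g (j + 1) := by
      funext x
      rw [mul_div_cancel_left₀ _ (hw.pos _ x).ne']
    have hder : IsGenDeriv (w (j + 1)) (g j) (fun x => w (j + 1) x * g (j + 1) x) := by
      refine ⟨(hc j (by omega)).measurable, (hw.measurable _).mul (hc _ hj).measurable, ?_,
        fun x y => hg j j.zero_le hj x y⟩
      rw [hdiv]
      exact mem_LD_of_continuous (hc _ hj)
    have hex : ∃ g', IsGenDeriv (w (j + 1)) (g j) g' := ⟨_, hder⟩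
    refine ⟨⟨ih1, by rw [ih2]; exact hex⟩, ?_⟩
    funext x
    rw [gDer, ih2, genDeriv, dif_pos hex,
      IsGenDeriv.unique hI hI' (hw.pos (j + 1)) hex.choose_spec hder]
    exact congrFun hdiv x

theorem IsChain.mem_wPolyCone (hI : I.OrdConnected) (hI' : I.Nontrivial) (hw : IsGauge w)
    {g : ℕ → I → ℝ} {k n : ℕ} (hg : IsChain w g 0 (n + 1)) (hc : ∀ j, Continuous (g j))
    (h0 : g (n + 1) = 0) (hmono : ∀ j, k ≤ j + 1 → j ≤ n → Monotone (g j)) :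
    (fun x => w 0 x * g 0 x) ∈ wPolyCone w k n := by
  have h := fun j (hj : j ≤ n + 1) => hg.gDer_eq hI hI' hw (fun j _ => hc j) hj
  refine ⟨⟨(h _ le_rfl).1, (h _ le_rfl).2.trans h0⟩, (h n n.le_succ).1, fun j hkj hjn => ?_⟩
  rw [(h j (by omega)).2]
  exact hmono j hkj hjn

/-- The chain obtained from a chain `g` starting at level `k` by integrating `w_k g_k` successively
down to level `0`, from the base point `z`; the members below level `k` are the iterated integrals
divided by the gauge functions. -/
noncomputable def prolong (w : ℕ → I → ℝ) (z : I) (k : ℕ) (g : ℕ → I → ℝ) (j : ℕ) : I → ℝ :=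
  if j < k then fun x => lift w z (k - j) j (fun u => w k u * g k u) x / w j x else g j

theorem mul_prolong (hw : IsGauge w) (z : I) {k j : ℕ} (g : ℕ → I → ℝ) (hj : j ≤ k) :
    (fun x => w j x * prolong w z k g j x) =
      lift w z (k - j) j (fun u => w k u * g k u) := by
  funext x
  rcases hj.lt_or_eq with h | rfl
  · rw [prolong, if_pos h, mul_div_cancel₀ _ (hw.pos j x).ne']
  · simp [prolong, lift]

theorem prolong_of_lt (hw : IsGauge w) (z : I) {k j : ℕ} (g : ℕ → I → ℝ) (hj : j < k) (x : I) :
    prolong w z k g j x =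
      ∫ u in (z : ℝ)..x, extendZero (fun u => w (j + 1) u * prolong w z k g (j + 1) u) u := by
  obtain ⟨d, rfl⟩ := Nat.exists_eq_add_of_lt hj
  rw [mul_prolong hw z g hj, prolong, if_pos hj, show j + d + 1 - j = d + 1 by omega,
    show j + d + 1 - (j + 1) = d by omega]
  simp only [lift]
  rw [mul_div_cancel_left₀ _ (hw.pos j x).ne']

theorem prolong_of_le (z : I) {k j : ℕ} (g : ℕ → I → ℝ) (hj : k ≤ j) :
    prolong w z k g j = g j := if_neg hj.not_gt

theorem locBdd_mul_prolong [I.OrdConnected] (hw : IsGauge w) {k : ℕ} {g : ℕ → I → ℝ}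
    (hk : LocBdd (g k)) {j : ℕ} (hj : j ≤ k) : LocBdd (fun x => w j x * prolong w z k g j x) := by
  rw [mul_prolong hw z g hj]
  exact ((hw.locBdd k).mul hk).lift hw z _ _

theorem continuous_prolong [I.OrdConnected] (hw : IsGauge w) {k : ℕ} {g : ℕ → I → ℝ}
    (hk : LocBdd (g k)) (hc : ∀ j, k ≤ j → Continuous (g j)) (j : ℕ) :
    Continuous (prolong w z k g j) := by
  rcases lt_or_ge j k with hj | hj
  · rw [show prolong w z k g j = _ from funext (prolong_of_lt hw z g hj)]
    exact continuous_integral (locBdd_mul_prolong hw hk hj) z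
  · rw [prolong_of_le z g hj]
    exact hc j hj

theorem isChain_prolong [I.OrdConnected] (hw : IsGauge w) {k m : ℕ} {g : ℕ → I → ℝ}
    (hk : LocBdd (g k)) (hg : IsChain w g k m) : IsChain w (prolong w z k g) 0 m := by
  intro j _ hjm x y
  rcases lt_or_ge j k with hj | hj
  · have hb := locBdd_mul_prolong (z := z) hw hk (Nat.succ_le_of_lt hj)
    refine ⟨hb.intervalIntegrable y x, ?_⟩
    rw [prolong_of_lt hw z g hj, prolong_of_lt hw z g hj,
      intervalIntegral.integral_add_adjacent_intervals (hb.intervalIntegrable z y)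
        (hb.intervalIntegrable y x)]
  · rw [prolong_of_le z g hj, prolong_of_le z g (hj.trans j.le_succ)]
    exact hg j hj hjm x y

theorem IsChain.monotone [I.OrdConnected] (hw : IsGauge w) {g : ℕ → I → ℝ} {i m j : ℕ}
    (hg : IsChain w g i m) (hj : i ≤ j) (hjm : j < m) (h : ∀ x, 0 ≤ g (j + 1) x) :
    Monotone (g j) := by
  intro y x hyx
  rw [(hg j hj hjm x y).2]
  have := integral_extendZero_nonneg hyx fun u _ => mul_nonneg (hw.pos (j + 1) u).le (h u)
  linarith

/-- The chain of the constant `1` at level `i`. -/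
noncomputable def unitChain (I : Set ℝ) (i j : ℕ) (_ : I) : ℝ := if j = i then 1 else 0

theorem extendZero_zero : extendZero (fun _ : I => (0 : ℝ)) = fun _ => 0 := by
  funext u
  simp [extendZero]

theorem isChain_unitChain [I.OrdConnected] (w : ℕ → I → ℝ) (i m : ℕ) :
    IsChain w (unitChain I i) i m := by
  intro j hj _ x y
  have h : (fun u : I => w (j + 1) u * unitChain I i (j + 1) u) = fun _ => 0 := by
    funext u
    simp [unitChain, show j + 1 ≠ i by omega]
  rw [h, extendZero_zero]
  simp [unitChain]

theorem ptPoly_eq_mul_prolong [I.OrdConnected] (hw : IsGauge w) (s : I) (i : ℕ) :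
    ptPoly w s 0 i = fun x => w 0 x * prolong w s i (unitChain I i) 0 x := by
  rw [mul_prolong hw s _ i.zero_le, ptPoly, ptPolyAux_eq_lift]
  simp [unitChain]

theorem isChain_prolong_unitChain [I.OrdConnected] (hw : IsGauge w) (s : I) (i m : ℕ) :
    IsChain w (prolong w s i (unitChain I i)) 0 m :=
  isChain_prolong hw (.const _) (isChain_unitChain w i m)

/-- The polynomials `p_{s;0,i}` of degree `i < k` lie in the cone together with their negatives,
since their gauged derivatives of orders at least `k - 1` are constant. -/
theorem ptPoly_mem_wPolyCone (hI : I.OrdConnected) (hI' : I.Nontrivial) (hw : IsGauge w)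
    {k n i : ℕ} (hi : i < k) (hkn : k ≤ n + 1) (s : I) :
    ptPoly w s 0 i ∈ wPolyCone w k n ∧ (fun x => -ptPoly w s 0 i x) ∈ wPolyCone w k n := by
  have hch := isChain_prolong_unitChain hw s i (n + 1)
  have hcont := continuous_prolong (z := s) hw (k := i) (g := unitChain I i) (.const _)
    fun j _ => continuous_const
  have htop : ∀ j, i ≤ j → prolong w s i (unitChain I i) j = fun _ => if j = i then 1 else 0 :=
    fun j hj => prolong_of_le s _ hj
  rw [ptPoly_eq_mul_prolong hw]
  constructor
  · refine hch.mem_wPolyCone hI hI' hw hcont ?_ fun j hj _ => ?_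
    · rw [htop _ (by omega), if_neg (by omega)]
      rfl
    · rw [htop _ (by omega)]
      exact monotone_const
  · simp only [← mul_neg]
    refine hch.neg.mem_wPolyCone hI hI' hw (fun j => (hcont j).neg) ?_ fun j hj _ => ?_
    · rw [htop _ (by omega), if_neg (by omega)]
      simp
      rfl
    · rw [htop _ (by omega)]
      exact monotone_const

end Chain

/-! ### Polynomials based at the left endpoint -/

section LeftPoly

variable {I : Set ℝ} {w : ℕ → I → ℝ} {z : I}

instance [hI : I.OrdConnected] : NullSingletonClass (lebesgue I) := by
  refine ⟨fun x => ?_⟩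
  rw [lebesgue, comap_subtype_coe_apply hI.measurableSet, image_singleton]
  simp

theorem lebesgue_Ioo_ne_zero [hI : I.OrdConnected] {x y : I} (hxy : x < y) :
    lebesgue I (Ioo x y) ≠ 0 := by
  rw [lebesgue, comap_subtype_coe_apply hI.measurableSet]
  have : Ioo (x : ℝ) y ⊆ Subtype.val '' Ioo x y := fun u hu =>
    ⟨⟨u, hI.out x.2 y.2 (Ioo_subset_Icc_self hu)⟩, hu, rfl⟩
  refine (lt_of_lt_of_le ?_ (measure_mono this)).ne'
  simpa using hxy

theorem setLIntegral_Iio_add [I.OrdConnected] (φ : I → ℝ≥0∞) {x y : I} (hxy : y ≤ x) :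
    ∫⁻ u in Iio x, φ u ∂lebesgue I =
      ∫⁻ u in Iio y, φ u ∂lebesgue I + ∫⁻ u in Ioc y x, φ u ∂lebesgue I := by
  rw [setLIntegral_congr Iio_ae_eq_Iic, setLIntegral_congr (Iio_ae_eq_Iic (a := y)),
    ← lintegral_union measurableSet_Ioc (Iic_disjoint_Ioc le_rfl), Iic_union_Ioc_eq_Iic hxy]

theorem setLIntegral_Ioc_eq_ofReal [I.OrdConnected] {φ : I → ℝ} (hφ : LocBdd φ)
    (h0 : ∀ x, 0 ≤ φ x) {x y : I} (hxy : y ≤ x) :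
    ∫⁻ u in Ioc y x, ENNReal.ofReal (φ u) ∂lebesgue I =
      ENNReal.ofReal (∫ u in (y : ℝ)..x, extendZero φ u) := by
  rw [← Real.enorm_of_nonneg (integral_extendZero_nonneg hxy fun u _ => h0 u),
    enorm_integral_of_nonneg hφ fun u _ => h0 u, uIoc_of_le hxy]
  simp only [Real.enorm_of_nonneg (h0 _)]

theorem sub_toReal_setLIntegral_Iio [I.OrdConnected] {φ : I → ℝ} (hφ : LocBdd φ)
    (h0 : ∀ x, 0 ≤ φ x) (hfin : ∀ x, ∫⁻ u in Iio x, ENNReal.ofReal (φ u) ∂lebesgue I < ∞)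
    (x y : I) :
    (∫⁻ u in Iio x, ENNReal.ofReal (φ u) ∂lebesgue I).toReal =
      (∫⁻ u in Iio y, ENNReal.ofReal (φ u) ∂lebesgue I).toReal +
        ∫ u in (y : ℝ)..x, extendZero φ u := by
  wlog hxy : y ≤ x generalizing x y
  · rw [this y x (le_of_not_ge hxy), intervalIntegral.integral_symm]
    ring
  rw [setLIntegral_Iio_add _ hxy, setLIntegral_Ioc_eq_ofReal hφ h0 hxy,
    ENNReal.toReal_add (hfin y).ne ENNReal.ofReal_ne_top,
    ENNReal.toReal_ofReal (integral_extendZero_nonneg hxy fun u _ => h0 u)]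

theorem locBdd_toReal_leftPoly [I.OrdConnected] (hw : IsGauge w) {j l : ℕ} (hl : l ≤ j)
    (h : ∀ x, leftPoly w l j x < ∞) : LocBdd (fun x => (leftPoly w l j x).toReal) := by
  rcases hl.lt_or_eq with hl | rfl
  · simp only [leftPoly_of_lt w hl, ENNReal.toReal_mul, ENNReal.toReal_ofReal (hw.pos l _).le]
    refine (hw.locBdd l).mul (.of_monotone fun y x hyx => ENNReal.toReal_mono ?_ ?_)
    · have := h x
      rw [leftPoly_of_lt w hl] at this
      exact fun h' => this.ne (by
        rw [h', ENNReal.mul_top (by simpa using hw.pos l x)])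
    · exact lintegral_mono_set (Iio_subset_Iio hyx)
  · simp only [leftPoly_self, ENNReal.toReal_ofReal (hw.pos l _).le]
    exact hw.locBdd l

theorem setLIntegral_leftPoly_lt_top [I.OrdConnected] (hw : IsGauge w) {j l : ℕ} (hl : l < j)
    {x : I} (h : leftPoly w l j x < ∞) : ∫⁻ u in Iio x, leftPoly w (l + 1) j u ∂lebesgue I < ∞ := by
  rw [leftPoly_of_lt w hl] at h
  exact lt_top_iff_ne_top.2 fun h' => h.ne (by
    rw [h', ENNReal.mul_top (by simpa using hw.pos l x)])

/-- If `p_{a;l,j}` is finite at `x`, then its integrand `p_{a;l+1,j}` is finite at some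
point to the right of any `x₀ < x`. -/
theorem exists_leftPoly_succ_lt_top [I.OrdConnected] (hw : IsGauge w) {j l : ℕ} (hl : l < j)
    {x₀ x : I} (hx : x₀ < x) (h : leftPoly w l j x < ∞) :
    ∃ y, x₀ < y ∧ leftPoly w (l + 1) j y < ∞ := by
  have hfin := setLIntegral_leftPoly_lt_top hw hl h
  have hae := ae_lt_top (measurable_leftPoly hw (Nat.succ_le_of_lt hl)) hfin.ne
  by_contra! hcon
  refine lebesgue_Ioo_ne_zero hx ?_
  rw [ae_restrict_iff' measurableSet_Iio] at hae
  refine measure_mono_null ?_ hae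
  intro u hu
  simpa using ⟨hu.2, top_le_iff.1 (hcon u hu.1)⟩

/-- Finiteness of `p_{a;l,j}` at one point other than the left endpoint of `I` propagates to all
of `I`, because the gauge functions are locally bounded. -/
theorem leftPoly_lt_top_of_exists [I.OrdConnected] (hw : IsGauge w) {j l : ℕ} (hl : l ≤ j)
    (h : ∃ x₀ x, x₀ < x ∧ leftPoly w l j x < ∞) (x : I) : leftPoly w l j x < ∞ := by
  induction hd : j - l generalizing l x with
  | zero =>
    obtain rfl : l = j := by omega
    rw [leftPoly_self]
    exact ENNReal.ofReal_lt_top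
  | succ d ih =>
    have hlj : l < j := by omega
    obtain ⟨x₀, x₁, hx, hfin⟩ := h
    obtain ⟨y, hy, hyfin⟩ := exists_leftPoly_succ_lt_top hw hlj hx hfin
    have hall := ih hlj ⟨x₀, y, hy, hyfin⟩ (hd := by omega)
    have hb := locBdd_toReal_leftPoly hw hlj hall
    rw [leftPoly_of_lt w hlj]
    refine ENNReal.mul_lt_top ENNReal.ofReal_lt_top ?_
    have h1 := setLIntegral_leftPoly_lt_top hw hlj hfin
    rcases le_total x x₁ with hxx | hxx
    · exact (lintegral_mono_set (Iio_subset_Iio hxx)).trans_lt h1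
    · rw [setLIntegral_Iio_add _ hxx]
      refine ENNReal.add_lt_top.2 ⟨h1, ?_⟩
      have := setLIntegral_Ioc_eq_ofReal hb (fun _ => ENNReal.toReal_nonneg) hxx
      simp only [ENNReal.ofReal_toReal (hall _).ne] at this
      rw [this]
      exact ENNReal.ofReal_lt_top

theorem leftPoly_lt_top_of_le [I.OrdConnected] (hI' : I.Nontrivial) (hw : IsGauge w) {k j l : ℕ}
    (hkl : k ≤ l) (hlj : l ≤ j) (h : ∀ x, leftPoly w k j x < ∞) (x : I) :
    leftPoly w l j x < ∞ := by
  induction l, hkl using Nat.le_induction generalizing x with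
  | base => exact h x
  | succ l _ ih =>
    obtain ⟨a, ha, b, hb, hab⟩ := hI'.exists_lt
    have hab' : (⟨a, ha⟩ : I) < ⟨b, hb⟩ := hab
    obtain ⟨y, hy, hyfin⟩ :=
      exists_leftPoly_succ_lt_top hw hlj hab' (ih (by omega) _)
    exact leftPoly_lt_top_of_exists hw hlj ⟨_, y, hy, hyfin⟩ x

/-- The chain of the gauged derivatives of `p_{a;k,j}` of orders at least `k`. -/
noncomputable def leftChain (w : ℕ → I → ℝ) (j l : ℕ) (x : I) : ℝ :=
  if l ≤ j then (leftPoly w l j x).toReal / w l x else 0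

theorem leftChain_nonneg (hw : IsGauge w) (j l : ℕ) (x : I) : 0 ≤ leftChain w j l x := by
  unfold leftChain
  split_ifs
  · exact div_nonneg ENNReal.toReal_nonneg (hw.pos l x).le
  · exact le_rfl

theorem mul_leftChain (hw : IsGauge w) {j l : ℕ} (h : l ≤ j) :
    (fun x => w l x * leftChain w j l x) = fun x => (leftPoly w l j x).toReal := by
  funext x
  rw [leftChain, if_pos h, mul_div_cancel₀ _ (hw.pos l x).ne']

theorem isChain_leftChain [I.OrdConnected] (hI' : I.Nontrivial) (hw : IsGauge w) {k j : ℕ}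
    (h : ∀ x, leftPoly w k j x < ∞) (m : ℕ) : IsChain w (leftChain w j) k m := by
  intro l hkl _ x y
  rcases lt_trichotomy l j with hl | rfl | hl
  · rw [mul_leftChain hw hl]
    have hfin := leftPoly_lt_top_of_le hI' hw (hkl.trans l.le_succ) hl h
    have hb := locBdd_toReal_leftPoly hw hl hfin
    refine ⟨hb.intervalIntegrable y x, ?_⟩
    have hval : ∀ x, leftChain w j l x = (∫⁻ u in Iio x,
        ENNReal.ofReal (leftPoly w (l + 1) j u).toReal ∂lebesgue I).toReal := by
      intro x
      simp only [ENNReal.ofReal_toReal (hfin _).ne]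
      rw [leftChain, if_pos hl.le, leftPoly_of_lt w hl, ENNReal.toReal_mul,
        ENNReal.toReal_ofReal (hw.pos l x).le, mul_div_cancel_left₀ _ (hw.pos l x).ne']
    rw [hval, hval]
    refine sub_toReal_setLIntegral_Iio hb (fun _ => ENNReal.toReal_nonneg) (fun x => ?_) x y
    simp only [ENNReal.ofReal_toReal (hfin _).ne]
    exact setLIntegral_leftPoly_lt_top hw hl (leftPoly_lt_top_of_le hI' hw hkl hl.le h x)
  · have h0 : (fun u => w (l + 1) u * leftChain w l (l + 1) u) = fun _ => 0 := by
      funext u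
      simp [leftChain]
    rw [h0, extendZero_zero]
    simp [leftChain, leftPoly_self, ENNReal.toReal_ofReal (hw.pos l _).le, (hw.pos l _).ne']
  · have h0 : (fun u => w (l + 1) u * leftChain w j (l + 1) u) = fun _ => 0 := by
      funext u
      simp [leftChain, show ¬ l + 1 ≤ j by omega]
    rw [h0, extendZero_zero]
    simp [leftChain, hl.not_ge]

theorem locBdd_leftChain [I.OrdConnected] (hI' : I.Nontrivial) (hw : IsGauge w) {k j : ℕ}
    (h : ∀ x, leftPoly w k j x < ∞) {l : ℕ} (hl : k ≤ l) : LocBdd (leftChain w j l) :=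
  .of_monotone ((isChain_leftChain hI' hw h (l + 1)).monotone hw hl (Nat.lt_succ_self l)
    (leftChain_nonneg hw j _))

theorem continuous_leftChain [I.OrdConnected] (hI' : I.Nontrivial) (hw : IsGauge w) {k j : ℕ}
    (h : ∀ x, leftPoly w k j x < ∞) {l : ℕ} (hl : k ≤ l) : Continuous (leftChain w j l) := by
  refine continuous_of_sub_eq_integral
    ((hw.locBdd (l + 1)).mul (locBdd_leftChain hI' hw h (hl.trans l.le_succ))) fun x y => ?_
  rw [((isChain_leftChain hI' hw h (l + 1)) l hl (Nat.lt_succ_self l) x y).2]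
  ring

theorem leftLift_eq_mul_prolong [I.OrdConnected] (hw : IsGauge w) (z : I) {k j : ℕ} (hkj : k ≤ j) :
    leftLift w z 0 k j = fun x => w 0 x * prolong w z k (leftChain w j) 0 x := by
  rw [mul_prolong hw z _ k.zero_le, leftLift, leftLiftAux_eq_lift, mul_leftChain hw hkj]
  simp

theorem leftLift_mem_wPolyCone (hI : I.OrdConnected) (hI' : I.Nontrivial) (hw : IsGauge w)
    {k n j : ℕ} (hj : j ∈ finSet w k n) (z : I) :
    leftLift w z 0 k j ∈ wPolyCone w k n := by
  obtain ⟨hkj, hjn, hfin⟩ := hj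
  have hch : IsChain w (prolong w z k (leftChain w j)) 0 (n + 1) :=
    isChain_prolong hw (locBdd_leftChain hI' hw hfin le_rfl) (isChain_leftChain hI' hw hfin _)
  rw [leftLift_eq_mul_prolong hw z hkj]
  refine hch.mem_wPolyCone hI hI' hw (continuous_prolong hw (locBdd_leftChain hI' hw hfin le_rfl)
    fun l hl => continuous_leftChain hI' hw hfin hl) ?_ fun l hl hln => ?_
  · rw [prolong_of_le z _ (by omega)]
    funext x
    simp [leftChain, show ¬ n + 1 ≤ j by omega]
  · refine hch.monotone hw l.zero_le (by omega) fun x => ?_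
    rw [prolong_of_le z _ hl]
    exact leftChain_nonneg hw j _ x

end LeftPoly

/-! ### Integrals with values in the extended reals -/

section ExtIntegral

variable {I : Set ℝ} {ν ν₁ ν₂ : Measure I} {f h p : I → ℝ}

theorem lintegral_neg_lt_top (hf : ⊥ < extIntegral ν f) :
    ∫⁻ x, ENNReal.ofReal (-f x) ∂ν < ∞ := by
  by_contra hcon
  rw [not_lt, top_le_iff] at hcon
  simp [extIntegral, hcon] at hf

theorem integrable_of_lintegral_lt_top (hf : Measurable f)
    (h1 : ∫⁻ x, ENNReal.ofReal (f x) ∂ν < ∞) (h2 : ∫⁻ x, ENNReal.ofReal (-f x) ∂ν < ∞) :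
    Integrable f ν := by
  refine ⟨hf.aestronglyMeasurable, ?_⟩
  rw [hasFiniteIntegral_iff_enorm]
  have : ∀ x, ‖f x‖ₑ = ENNReal.ofReal (f x) + ENNReal.ofReal (-f x) := by
    intro x
    rw [Real.enorm_eq_ofReal_abs]
    rcases le_total 0 (f x) with h | h
    · rw [abs_of_nonneg h, ENNReal.ofReal_of_nonpos (neg_nonpos.2 h), add_zero]
    · rw [abs_of_nonpos h, ENNReal.ofReal_of_nonpos h, zero_add]
  simp only [this]
  rw [lintegral_add_left hf.ennreal_ofReal]
  exact ENNReal.add_lt_top.2 ⟨h1, h2⟩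

theorem extIntegral_eq_integral (hf : Integrable f ν) :
    ExtIntegrable ν f ∧ extIntegral ν f = ((∫ x, f x ∂ν : ℝ) : EReal) := by
  have h1 : ∫⁻ x, ENNReal.ofReal (f x) ∂ν < ∞ := hf.lintegral_lt_top
  have h2 : ∫⁻ x, ENNReal.ofReal (-f x) ∂ν < ∞ := hf.neg.lintegral_lt_top
  refine ⟨Or.inl h1, ?_⟩
  rw [integral_eq_lintegral_pos_part_sub_lintegral_neg_part hf, EReal.coe_sub,
    EReal.coe_ennreal_toReal h1.ne, EReal.coe_ennreal_toReal h2.ne]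
  rfl

theorem integrable_of_extIntegral_eq_coe (hf : Measurable f) {r : ℝ}
    (h : extIntegral ν f = (r : EReal)) : Integrable f ν ∧ ∫ x, f x ∂ν = r := by
  have h2 : ∫⁻ x, ENNReal.ofReal (-f x) ∂ν < ∞ :=
    lintegral_neg_lt_top (by rw [h]; exact EReal.bot_lt_coe r)
  have h1 : ∫⁻ x, ENNReal.ofReal (f x) ∂ν < ∞ := by
    by_contra hcon
    rw [not_lt, top_le_iff] at hcon
    have hne : -((∫⁻ x, ENNReal.ofReal (-f x) ∂ν : ℝ≥0∞) : EReal) ≠ ⊥ := by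
      simpa using h2.ne
    rw [extIntegral, hcon, EReal.coe_ennreal_top, sub_eq_add_neg, EReal.top_add_of_ne_bot hne] at h
    exact EReal.coe_ne_top r h.symm
  have hint := integrable_of_lintegral_lt_top hf h1 h2
  refine ⟨hint, ?_⟩
  rw [(extIntegral_eq_integral hint).2] at h
  exact_mod_cast h

/-- When the negative parts are integrable, `ν₂(f) ≤ ν₁(f)` can be written without subtraction. -/
theorem extIntegralGE_iff (h1 : ∫⁻ x, ENNReal.ofReal (-f x) ∂ν₁ < ∞)
    (h2 : ∫⁻ x, ENNReal.ofReal (-f x) ∂ν₂ < ∞) :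
    ExtIntegralGE ν₁ ν₂ f ↔
      ∫⁻ x, ENNReal.ofReal (f x) ∂ν₂ + ∫⁻ x, ENNReal.ofReal (-f x) ∂ν₁ ≤
        ∫⁻ x, ENNReal.ofReal (f x) ∂ν₁ + ∫⁻ x, ENNReal.ofReal (-f x) ∂ν₂ := by
  have : ExtIntegralGE ν₁ ν₂ f ↔ extIntegral ν₂ f ≤ extIntegral ν₁ f :=
    ⟨fun h => h.2.2, fun h => ⟨Or.inr h1, Or.inr h2, h⟩⟩
  rw [this, extIntegral, extIntegral]
  generalize ∫⁻ x, ENNReal.ofReal (-f x) ∂ν₁ = n₁ at *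
  generalize ∫⁻ x, ENNReal.ofReal (-f x) ∂ν₂ = n₂ at *
  generalize ∫⁻ x, ENNReal.ofReal (f x) ∂ν₁ = p₁
  generalize ∫⁻ x, ENNReal.ofReal (f x) ∂ν₂ = p₂
  lift n₁ to NNReal using h1.ne
  lift n₂ to NNReal using h2.ne
  have hn (n : NNReal) : (((n : ℝ≥0∞)) : EReal) = ((n : ℝ) : EReal) := rfl
  induction p₁ with
  | top => simp [hn]
  | coe p₁ =>
    induction p₂ with
    | top =>
      simp only [hn, EReal.coe_ennreal_top, EReal.top_sub_coe, top_add, top_le_iff]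
      constructor
      · intro h
        rw [← EReal.coe_sub] at h
        exact absurd h (EReal.coe_ne_top _)
      · intro h
        exact absurd h (by simp)
    | coe p₂ =>
      simp only [hn, ← EReal.coe_sub, EReal.coe_le_coe_iff]
      rw [← ENNReal.coe_add, ← ENNReal.coe_add, ENNReal.coe_le_coe, ← NNReal.coe_le_coe]
      push_cast
      constructor <;> intro h <;> linarith

/-- The function `p` is integrable for both measures, with the same integral. -/
structure SameIntegral (ν₁ ν₂ : Measure I) (p : I → ℝ) : Prop where
  left : Integrable p ν₁
  right : Integrable p ν₂
  eq : ∫ x, p x ∂ν₁ = ∫ x, p x ∂ν₂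

theorem SameIntegral.neg (hp : SameIntegral ν₁ ν₂ p) : SameIntegral ν₁ ν₂ (fun x => -p x) :=
  ⟨hp.1.neg, hp.2.neg, by rw [integral_neg, integral_neg, hp.3]⟩

theorem SameIntegral.sum {ι : Type*} (s : Finset ι) (c : ι → ℝ) {q : ι → I → ℝ}
    (hq : ∀ i ∈ s, SameIntegral ν₁ ν₂ (q i)) :
    SameIntegral ν₁ ν₂ (fun x => ∑ i ∈ s, c i * q i x) := by
  refine ⟨integrable_finsetSum _ fun i hi => (hq i hi).1.const_mul _,
    integrable_finsetSum _ fun i hi => (hq i hi).2.const_mul _, ?_⟩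
  rw [integral_finsetSum _ fun i hi => (hq i hi).1.const_mul _,
    integral_finsetSum _ fun i hi => (hq i hi).2.const_mul _]
  refine Finset.sum_congr rfl fun i hi => ?_
  rw [integral_const_mul, integral_const_mul, (hq i hi).3]

theorem extIntegralGE_iff_of_integrable (h1 : Integrable f ν₁) (h2 : Integrable f ν₂) :
    ExtIntegralGE ν₁ ν₂ f ↔ ∫ x, f x ∂ν₂ ≤ ∫ x, f x ∂ν₁ := by
  obtain ⟨e1, i1⟩ := extIntegral_eq_integral h1
  obtain ⟨e2, i2⟩ := extIntegral_eq_integral h2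
  rw [← EReal.coe_le_coe_iff, ← i1, ← i2]
  exact ⟨fun h => h.2.2, fun h => ⟨e1, e2, h⟩⟩

theorem SameIntegral.extIntegralEqReal (hp : SameIntegral ν₁ ν₂ p) :
    ExtIntegralEqReal ν₁ ν₂ p :=
  ⟨(extIntegral_eq_integral hp.1).1, (extIntegral_eq_integral hp.2).1, _,
    (extIntegral_eq_integral hp.1).2, by rw [(extIntegral_eq_integral hp.2).2, hp.3]⟩

theorem ExtIntegralEqReal.sameIntegral (hm : Measurable p) (hp : ExtIntegralEqReal ν₁ ν₂ p) :
    SameIntegral ν₁ ν₂ p := by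
  obtain ⟨-, -, r, h1, h2⟩ := hp
  obtain ⟨i1, e1⟩ := integrable_of_extIntegral_eq_coe hm h1
  obtain ⟨i2, e2⟩ := integrable_of_extIntegral_eq_coe hm h2
  exact ⟨i1, i2, e1.trans e2.symm⟩

theorem lintegral_ofReal_add_lt_top (hm : Measurable f)
    (hf : ∫⁻ x, ENNReal.ofReal (f x) ∂ν < ∞) (hp : Integrable p ν) :
    ∫⁻ x, ENNReal.ofReal (f x + p x) ∂ν < ∞ := by
  refine (lintegral_mono fun x => ENNReal.ofReal_add_le).trans_lt ?_
  rw [lintegral_add_left hm.ennreal_ofReal]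
  exact ENNReal.add_lt_top.2 ⟨hf, hp.lintegral_lt_top⟩

/-- Adding a function with the same finite integral for both measures preserves the comparison. -/
theorem ExtIntegralGE.add (hm : Measurable h) (hpm : Measurable p)
    (h1 : ∫⁻ x, ENNReal.ofReal (-h x) ∂ν₁ < ∞) (h2 : ∫⁻ x, ENNReal.ofReal (-h x) ∂ν₂ < ∞)
    (hp : SameIntegral ν₁ ν₂ p) (hh : ExtIntegralGE ν₁ ν₂ h) :
    ExtIntegralGE ν₁ ν₂ (fun x => h x + p x) := by
  have hneg {ν : Measure I} (hν : ∫⁻ x, ENNReal.ofReal (-h x) ∂ν < ∞) (hp : Integrable p ν) :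
      ∫⁻ x, ENNReal.ofReal (-(h x + p x)) ∂ν < ∞ := by
    simpa only [neg_add, Pi.neg_apply] using lintegral_ofReal_add_lt_top hm.neg hν hp.neg
  have g1 := hneg h1 hp.1
  have g2 := hneg h2 hp.2
  -- Unless `ν₁(h + p) = ∞`, all the positive parts are integrable too.
  rcases eq_or_ne (∫⁻ x, ENNReal.ofReal (h x + p x) ∂ν₁) ∞ with htop | hfin
  · rw [extIntegralGE_iff g1 g2, htop, top_add]
    exact le_top
  · have hpos1 : ∫⁻ x, ENNReal.ofReal (h x) ∂ν₁ < ∞ := by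
      have := lintegral_ofReal_add_lt_top (p := fun x => -p x) (hm.add hpm)
        (lt_top_iff_ne_top.2 hfin) hp.1.neg
      simpa using this
    have hpos2 : ∫⁻ x, ENNReal.ofReal (h x) ∂ν₂ < ∞ := by
      rw [extIntegralGE_iff h1 h2] at hh
      exact (le_self_add.trans hh).trans_lt (ENNReal.add_lt_top.2 ⟨hpos1, h2⟩)
    have i1 := integrable_of_lintegral_lt_top hm hpos1 h1
    have i2 := integrable_of_lintegral_lt_top hm hpos2 h2
    rw [extIntegralGE_iff_of_integrable i1 i2] at hh
    refine (extIntegralGE_iff_of_integrable (i1.add hp.1) (i2.add hp.2)).2 ?_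
    simp only [Pi.add_apply]
    rw [integral_add i1 hp.1,
      integral_add i2 hp.2, hp.3]
    linarith

end ExtIntegral

/-! ### Functions with a sign pattern -/

section SignMeasure

variable {I : Set ℝ} {w : ℕ → I → ℝ} {z : I} {ν₁ ν₂ : Measure I}

/-- The measure equal to `μ` on the set where functions of sign pattern `m` are nonnegative, and
to `ν` on its complement. -/
noncomputable def signMeasure (z : I) (m : ℕ) (μ ν : Measure I) : Measure I :=
  μ.restrict {x | z ≤ x ∨ Even m} + ν.restrict {x | z ≤ x ∨ Even m}ᶜ

theorem lintegral_signMeasure (m : ℕ) (μ ν : Measure I) {h : I → ℝ} (hh : SignPattern z m h) :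
    ∫⁻ x, ‖h x‖ₑ ∂signMeasure z m μ ν =
      ∫⁻ x, ENNReal.ofReal (h x) ∂μ + ∫⁻ x, ENNReal.ofReal (-h x) ∂ν := by
  have hA : MeasurableSet {x : I | z ≤ x ∨ Even m} :=
    measurableSet_Ici.union (MeasurableSet.const _)
  have hpos : ∀ x ∈ {x : I | z ≤ x ∨ Even m}, 0 ≤ h x := by
    rintro x (hx | hm)
    · exact (hh x).1 hx
    · rcases le_total z x with hx | hx
      · exact (hh x).1 hx
      · simpa [hm.neg_one_pow] using (hh x).2 hx
  have hneg : ∀ x ∈ {x : I | z ≤ x ∨ Even m}ᶜ, h x ≤ 0 := by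
    intro x hx
    rw [mem_compl_iff, mem_ofPred_eq, not_or, Nat.not_even_iff_odd] at hx
    simpa [hx.2.neg_one_pow] using (hh x).2 (le_of_not_ge hx.1)
  rw [signMeasure, lintegral_add_measure, ← lintegral_indicator hA, ← lintegral_indicator hA.compl]
  congr 1 <;> refine lintegral_congr fun x => ?_
  · by_cases hx : x ∈ {x : I | z ≤ x ∨ Even m}
    · rw [indicator_of_mem hx, Real.enorm_of_nonneg (hpos x hx)]
    · rw [indicator_of_notMem hx, ENNReal.ofReal_of_nonpos (hneg x hx)]
  · by_cases hx : x ∈ {x : I | z ≤ x ∨ Even m}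
    · rw [indicator_of_notMem (not_not.2 hx),
        ENNReal.ofReal_of_nonpos (neg_nonpos.2 (hpos x hx))]
    · rw [indicator_of_mem hx, ← enorm_neg, Real.enorm_of_nonneg (neg_nonneg.2 (hneg x hx))]

theorem lintegral_signMeasure_lt_top (m : ℕ) {μ ν : Measure I} {h : I → ℝ}
    (hμ : Integrable h μ) (hν : Integrable h ν) :
    ∫⁻ x, ‖h x‖ₑ ∂signMeasure z m μ ν < ∞ := by
  rw [signMeasure, lintegral_add_measure]
  exact ENNReal.add_lt_top.2 ⟨(setLIntegral_le_lintegral _ _).trans_lt hμ.2,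
    (setLIntegral_le_lintegral _ _).trans_lt hν.2⟩

/-- Up to a `w`-polynomial of degree at most `N`, a function with a nondecreasing gauged derivative
of order `N` has a prescribed sign on either side of `z`.  If the two measures agree on these
polynomials, the comparison of the integrals is thus a comparison of integrals of a nonnegative
function. -/
theorem IsChain.extIntegralGE_iff [I.OrdConnected] (hw : IsGauge w) {g : ℕ → I → ℝ} {N : ℕ}
    (hg : IsChain w g 0 N) (hmono : Monotone (g N)) (hm : Measurable (g 0))
    (hp : ∀ l ≤ N, SameIntegral ν₁ ν₂ (ptPoly w z 0 l))
    (h1 : ∫⁻ x, ENNReal.ofReal (-(w 0 x * g 0 x)) ∂ν₁ < ∞)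
    (h2 : ∫⁻ x, ENNReal.ofReal (-(w 0 x * g 0 x)) ∂ν₂ < ∞) :
    ExtIntegralGE ν₁ ν₂ (fun x => w 0 x * g 0 x) ↔
      ∫⁻ x, ‖lift w z N 0 (fun x => w N x * (g N x - g N z)) x‖ₑ ∂signMeasure z (N + 1) ν₂ ν₁ ≤
        ∫⁻ x, ‖lift w z N 0 (fun x => w N x * (g N x - g N z)) x‖ₑ
          ∂signMeasure z (N + 1) ν₁ ν₂ := by
  have htaylor := hg.mono (i' := 0) (m' := 0 + N) le_rfl (by omega) |>.taylor hw (z := z) N 0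
  simp only [Nat.zero_add] at htaylor
  set h := lift w z N 0 (fun x => w N x * (g N x - g N z))
  set p : I → ℝ := fun x => ∑ l ∈ Finset.range (N + 1), g l z * ptPolyAux w z l 0 x
  have hsign : SignPattern z (N + 1) h := by
    rw [add_comm]
    exact ((SignPattern.of_monotone hmono z).mul_left (hw.pos N)).lift hw N 0
  have hb : LocBdd h :=
    ((hw.locBdd N).mul ((LocBdd.of_monotone hmono).sub (.const _))).lift hw z N 0
  have hpS : SameIntegral ν₁ ν₂ p :=
    .sum _ _ fun l hl => hp l (Nat.lt_succ_iff.1 (Finset.mem_range.1 hl))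
  have hfm : Measurable (fun x => w 0 x * g 0 x) := (hw.measurable 0).mul hm
  have hpm : Measurable p := by
    have : p = fun x => w 0 x * g 0 x - h x := by
      funext x
      rw [htaylor x]
      ring
    rw [this]
    exact hfm.sub hb.1
  have hhneg {ν : Measure I} (hν : ∫⁻ x, ENNReal.ofReal (-(w 0 x * g 0 x)) ∂ν < ∞)
      (hp : Integrable p ν) : ∫⁻ x, ENNReal.ofReal (-h x) ∂ν < ∞ := by
    have := lintegral_ofReal_add_lt_top hfm.neg hν hp
    refine lt_of_eq_of_lt (lintegral_congr fun x => ?_) this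
    simp only [htaylor x, Pi.neg_apply]
    congr 1
    ring
  have n1 := hhneg h1 hpS.1
  have n2 := hhneg h2 hpS.2
  rw [lintegral_signMeasure _ _ _ hsign, lintegral_signMeasure _ _ _ hsign,
    ← GaugedCone.extIntegralGE_iff n1 n2]
  constructor
  · intro hf
    have := hf.add hfm hpm.neg h1 h2 hpS.neg
    convert this using 1
    funext x
    simp only [htaylor x, Pi.neg_apply]
    ring
  · intro hh
    have := hh.add hb.1 hpm n1 n2 hpS
    convert this using 1
    funext x
    exact htaylor x

theorem lintegral_bind_iterKernel (μ : Measure I) (κ : ℕ → Kernel I I) (e i : ℕ)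
    {φ : I → ℝ≥0∞} (hφ : Measurable φ) :
    ∫⁻ u, φ u ∂μ.bind (iterKernel κ e i) = ∫⁻ x, ∫⁻ u, φ u ∂iterKernel κ e i x ∂μ :=
  Measure.lintegral_bind (Kernel.aemeasurable _) hφ.aemeasurable

end SignMeasure

/-! ### Comparison of measures on monotone functions -/

section LayerCake

variable {I : Set ℝ} {α β : Measure I}

/-- An up-set is a countable union of closed half-lines. -/
theorem exists_seq_Ici_cover [I.OrdConnected] {U : Set I} (hU : IsUpperSet U) (hne : U.Nonempty) :
    ∃ t : ℕ → I, (∀ m, t m ∈ U) ∧ ∀ u ∈ U, ∃ m, t m ≤ u := by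
  have := hU.ordConnected
  have : Nonempty U := hne.to_subtype
  obtain ⟨t, ht⟩ := (atBot : Filter U).exists_seq_tendsto
  refine ⟨fun m => t m, fun m => (t m).2, fun u hu => ?_⟩
  exact (ht.eventually (eventually_le_atBot ⟨u, hu⟩)).exists

theorem measure_le_of_isUpperSet [I.OrdConnected] {U : Set I} (hU : IsUpperSet U)
    (h : ∀ t ∈ U, β (Ici t) ≤ α (Ici t)) : β U ≤ α U := by
  rcases U.eq_empty_or_nonempty with rfl | hne
  · simp
  obtain ⟨t, htU, ht⟩ := exists_seq_Ici_cover hU hne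
  have hUeq : U = ⋃ m, Ici (t m) := by
    ext u
    simp only [mem_iUnion, mem_Ici]
    exact ⟨ht u, fun ⟨m, hm⟩ => hU hm (htU m)⟩
  have hdir : Directed (· ⊆ ·) fun m => Ici (t m) := by
    intro a b
    rcases le_total (t a) (t b) with hab | hab
    · exact ⟨a, subset_rfl, Ici_subset_Ici.2 hab⟩
    · exact ⟨b, Ici_subset_Ici.2 hab, subset_rfl⟩
  rw [hUeq, hdir.measure_iUnion, hdir.measure_iUnion]
  exact iSup_mono fun m => h _ (htU m)

/-- Only open half-lines are compared, so a down-set with a greatest element is reached as a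
decreasing intersection; this is where finiteness of the measures enters. -/
theorem measure_le_of_isLowerSet [I.OrdConnected] [IsFiniteMeasure α] [IsFiniteMeasure β] {z : I}
    (h : ∀ t ≤ z, β (Iio t) ≤ α (Iio t)) {D : Set I} (hD : IsLowerSet D) (hz : z ∉ D) :
    β D ≤ α D := by
  obtain ⟨t, htU, ht⟩ := exists_seq_Ici_cover hD.compl ⟨z, hz⟩
  have hDeq : D = ⋂ m, Iio (min z (t m)) := by
    ext u
    simp only [mem_iInter, mem_Iio]
    constructor
    · intro hu m
      refine lt_of_not_ge fun hm => ?_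
      have := hD hm hu
      rcases min_choice z (t m) with h' | h'
      · exact hz (h' ▸ this)
      · exact htU m (h' ▸ this)
    · intro hu
      by_contra hcon
      obtain ⟨m, hm⟩ := ht u hcon
      exact (hu m).not_ge ((min_le_right _ _).trans hm)
  have hdir : Directed (· ⊇ ·) fun m => Iio (min z (t m)) := by
    intro a b
    rcases le_total (min z (t a)) (min z (t b)) with hab | hab
    · exact ⟨a, subset_rfl, Iio_subset_Iio hab⟩
    · exact ⟨b, Iio_subset_Iio hab, subset_rfl⟩
  have hms : ∀ m, MeasurableSet (Iio (min z (t m))) := fun _ => measurableSet_Iio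
  rw [hDeq, hdir.measure_iInter (fun m => (hms m).nullMeasurableSet) ⟨0, measure_ne_top _ _⟩,
    hdir.measure_iInter (fun m => (hms m).nullMeasurableSet) ⟨0, measure_ne_top _ _⟩]
  exact iInf_mono fun m => h _ (min_le_left _ _)

theorem lintegral_le_of_monotone [I.OrdConnected] (h : ∀ t, β (Ici t) ≤ α (Ici t)) {g : I → ℝ}
    (hg : Monotone g) (h0 : ∀ x, 0 ≤ g x) :
    ∫⁻ x, ENNReal.ofReal (g x) ∂β ≤ ∫⁻ x, ENNReal.ofReal (g x) ∂α := by
  rw [lintegral_eq_lintegral_meas_lt β (Eventually.of_forall h0) hg.measurable.aemeasurable,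
    lintegral_eq_lintegral_meas_lt α (Eventually.of_forall h0) hg.measurable.aemeasurable]
  refine lintegral_mono fun r => measure_le_of_isUpperSet ?_ fun t _ => h t
  exact fun a b hab ha => lt_of_lt_of_le ha (hg hab)

/-- Comparison of two finite measures on the absolute increment of a nondecreasing function. -/
theorem lintegral_enorm_sub_le_of_monotone [I.OrdConnected] [IsFiniteMeasure α]
    [IsFiniteMeasure β] {z : I} (h1 : ∀ t, z < t → β (Ici t) ≤ α (Ici t))
    (h2 : ∀ t ≤ z, β (Iio t) ≤ α (Iio t)) {g : I → ℝ} (hg : Monotone g) :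
    ∫⁻ x, ‖g x - g z‖ₑ ∂β ≤ ∫⁻ x, ‖g x - g z‖ₑ ∂α := by
  have hm : Measurable (fun x => |g x - g z|) := (hg.measurable.sub_const _).abs
  simp only [Real.enorm_eq_ofReal_abs]
  rw [lintegral_eq_lintegral_meas_lt β (Eventually.of_forall fun _ => abs_nonneg _) hm.aemeasurable,
    lintegral_eq_lintegral_meas_lt α (Eventually.of_forall fun _ => abs_nonneg _) hm.aemeasurable]
  refine setLIntegral_mono' measurableSet_Ioi fun r hr => ?_
  have hr' : (0 : ℝ) < r := hr
  have hset : {x | r < |g x - g z|} = {x | r < g x - g z} ∪ {x | r < g z - g x} := by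
    ext x
    simp only [mem_ofPred_eq, mem_union, lt_abs, neg_sub]
  have hU : IsUpperSet {x | r < g x - g z} := fun a b hab (ha : r < g a - g z) => by
    have := hg hab
    show r < g b - g z
    linarith
  have hD : IsLowerSet {x | r < g z - g x} := fun a b hab (ha : r < g z - g a) => by
    have := hg hab
    show r < g z - g b
    linarith
  have hdisj : Disjoint {x | r < g x - g z} {x | r < g z - g x} := by
    rw [disjoint_left]
    intro x (hx : r < g x - g z) (hx' : r < g z - g x)
    linarith
  rw [hset, measure_union hdisj hD.ordConnected.measurableSet,
    measure_union hdisj hD.ordConnected.measurableSet]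
  refine add_le_add ?_ (measure_le_of_isLowerSet h2 hD ?_)
  · refine measure_le_of_isUpperSet hU fun t (ht : r < g t - g z) =>
      h1 t (lt_of_not_ge fun htz => ?_)
    have := hg htz
    linarith
  · intro (hz : r < g z - g z)
    linarith

end LayerCake

/-! ### Expansion at the left endpoint -/

section LeftExpansion

variable {I : Set ℝ} {w : ℕ → I → ℝ} {z : I}

/-- Gauged derivatives of nondecreasing derivatives are nonnegative.  One-sided continuity is needed
only at the left endpoint of `I`, where monotonicity gives no information. -/
theorem IsChain.nonneg_of_monotone [hI : I.OrdConnected] (hI' : I.Nontrivial) (hw : IsGauge w)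
    {g : ℕ → I → ℝ} {j : ℕ} (hg : IsChain w g j (j + 1)) (h0 : Monotone (g j))
    (h1 : Monotone (g (j + 1))) (hLD : g (j + 1) ∈ LD I) (x : I) : 0 ≤ g (j + 1) x := by
  by_contra! hx
  obtain ⟨y, y', hyy, hneg⟩ : ∃ y y' : I, y < y' ∧ ∀ u, y < u → u < y' → g (j + 1) u < 0 := by
    by_cases hmin : ∃ y, y < x
    · obtain ⟨y, hy⟩ := hmin
      exact ⟨y, x, hy, fun u _ hu => (h1 hu.le).trans_lt hx⟩
    -- At the left endpoint the strict inequality spreads to the right by right-continuity.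
    · push Not at hmin
      obtain ⟨v, hv, hne⟩ := hI'.exists_ne (x : ℝ)
      have hxv : x < ⟨v, hv⟩ :=
        lt_of_le_of_ne (hmin _) fun h => hne (congrArg Subtype.val h).symm
      have hcont := hLD.1 x fun htop => (htop ⟨v, hv⟩).not_gt hxv
      have hev : ∀ᶠ u in 𝓝[≥] x, g (j + 1) u < 0 := hcont.eventually (gt_mem_nhds hx)
      obtain ⟨y', hy', hsub⟩ := (mem_nhdsGE_iff_exists_Ico_subset' hxv).1 hev
      exact ⟨x, y', hy', fun u hu hu' => hsub ⟨hu.le, hu'⟩⟩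
  obtain ⟨hint, heq⟩ := hg j le_rfl (Nat.lt_succ_self j) y' y
  have hpos : 0 < ∫ u in (y : ℝ)..y', -extendZero (fun u => w (j + 1) u * g (j + 1) u) u := by
    refine intervalIntegral.intervalIntegral_pos_of_pos_on hint.neg (fun u hu => ?_) hyy
    have hu' : u ∈ I := hI.out y.2 y'.2 (Ioo_subset_Icc_self hu)
    have h2 := hneg ⟨u, hu'⟩ hu.1 hu.2
    have h3 := mul_neg_of_pos_of_neg (hw.pos (j + 1) ⟨u, hu'⟩) h2
    simpa [extendZero, hu'] using h3
  rw [intervalIntegral.integral_neg] at hpos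
  have := h0 hyy.le
  linarith

/-- A nondecreasing function which is bounded below and has a density on `I` is recovered from its
limit at the left endpoint of `I`. -/
theorem ofReal_sub_iInf [I.OrdConnected] {f φ : I → ℝ} (hf : Monotone f)
    (hbdd : BddBelow (range f)) (hφ : LocBdd φ) (h0 : ∀ x, 0 ≤ φ x)
    (hfφ : ∀ x y : I, f x = f y + ∫ u in (y : ℝ)..x, extendZero φ u) (x : I) :
    ENNReal.ofReal (f x - ⨅ y, f y) = ∫⁻ u in Iio x, ENNReal.ofReal (φ u) ∂lebesgue I := by
  obtain ⟨t, -, ht⟩ := exists_seq_Ici_cover (isUpperSet_univ (α := I)) ⟨x, mem_univ x⟩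
  have hIic : Iic x = ⋃ m, Icc (t m) x := by
    ext u
    simp only [mem_iUnion, mem_Icc, mem_Iic]
    exact ⟨fun hu => (ht u (mem_univ u)).imp fun m hm => ⟨hm, hu⟩, fun ⟨m, hm⟩ => hm.2⟩
  have hdir : Directed (· ⊆ ·) fun m => Icc (t m) x := by
    intro a b
    rcases le_total (t a) (t b) with hab | hab
    · exact ⟨a, subset_rfl, Icc_subset_Icc_left hab⟩
    · exact ⟨b, Icc_subset_Icc_left hab, subset_rfl⟩
  have hval : ∀ m, ∫⁻ u in Icc (t m) x, ENNReal.ofReal (φ u) ∂lebesgue I =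
      ENNReal.ofReal (f x - f (t m)) := by
    intro m
    rcases le_total (t m) x with hm | hm
    · rw [← setLIntegral_congr Ioc_ae_eq_Icc, setLIntegral_Ioc_eq_ofReal hφ h0 hm, hfφ x (t m)]
      congr 1
      ring
    · rw [← setLIntegral_congr Ioc_ae_eq_Icc, Ioc_eq_empty hm.not_gt,
        ENNReal.ofReal_of_nonpos (sub_nonpos.2 (hf hm))]
      simp
  rw [setLIntegral_congr Iio_ae_eq_Iic, hIic, setLIntegral_iUnion_of_directed _ hdir]
  simp only [hval]
  refine le_antisymm (le_of_forall_lt fun a ha => ?_) (iSup_le fun m => ?_)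
  · have : Nonempty I := ⟨x⟩
    have ha' : a ≠ ∞ := (ha.trans ENNReal.ofReal_lt_top).ne
    rw [ENNReal.lt_ofReal_iff_toReal_lt ha'] at ha
    obtain ⟨y, hy⟩ := exists_lt_of_ciInf_lt (show ⨅ y, f y < f x - a.toReal by linarith)
    obtain ⟨m, hm⟩ := ht y (mem_univ y)
    refine lt_of_lt_of_le ?_ (le_iSup _ m)
    rw [ENNReal.lt_ofReal_iff_toReal_lt ha']
    have := hf hm
    linarith
  · exact ENNReal.ofReal_le_ofReal (sub_le_sub_left (ciInf_le hbdd _) _)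

/-- Expansion of a gauged derivative at the left endpoint of `I`: the coefficients are the limits
there of the derivatives of higher order, and the remainder is an iterated integral of the top
derivative. -/
theorem IsChain.left_expansion [I.OrdConnected] (hw : IsGauge w) {g : ℕ → I → ℝ} {i n : ℕ}
    (hin : i ≤ n) (hg : IsChain w g i n) (hmono : ∀ j, i ≤ j → j ≤ n → Monotone (g j))
    (h0 : ∀ j, i ≤ j → j ≤ n → ∀ x, 0 ≤ g j x) (x : I) :
    ENNReal.ofReal (w i x * g i x) =
      ∑ j ∈ Finset.Ico i (n + 1), ENNReal.ofReal (⨅ y, g j y) * leftPoly w i j x +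
        ∫⁻ u, ENNReal.ofReal (w n u * (g n u - ⨅ y, g n y))
          ∂iterKernel (leftKernel w) (n - i) i x := by
  have hx : Nonempty I := ⟨x⟩
  have hbdd : ∀ j, i ≤ j → j ≤ n → BddBelow (range (g j)) := fun j h h' =>
    ⟨0, by rintro _ ⟨y, rfl⟩; exact h0 j h h' y⟩
  have hsplit : ∀ j, i ≤ j → j ≤ n → ∀ x, ENNReal.ofReal (w j x * g j x) =
      ENNReal.ofReal (⨅ y, g j y) * leftPoly w j j x +
        ENNReal.ofReal (w j x * (g j x - ⨅ y, g j y)) := by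
    intro j h h' x
    have hc : 0 ≤ ⨅ y, g j y := le_ciInf (h0 j h h')
    have hle : 0 ≤ g j x - ⨅ y, g j y := sub_nonneg.2 (ciInf_le (hbdd j h h') x)
    rw [leftPoly_self, ← ENNReal.ofReal_mul hc,
      ← ENNReal.ofReal_add (mul_nonneg hc (hw.pos j x).le) (mul_nonneg (hw.pos j x).le hle)]
    congr 1
    ring
  have hmn : Measurable (fun u => ENNReal.ofReal (w n u * (g n u - ⨅ y, g n y))) :=
    ((hw.measurable n).mul ((hmono n hin le_rfl).measurable.sub_const _)).ennreal_ofReal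
  induction hd : n - i generalizing i x with
  | zero =>
    obtain rfl : i = n := by omega
    rw [lintegral_iterKernel_zero _ _ hmn, Nat.Ico_succ_singleton, Finset.sum_singleton]
    exact hsplit i le_rfl le_rfl x
  | succ d ih =>
    have hlt : i < n := by omega
    have ih' := fun x => ih (i := i + 1) hlt (hg.mono i.le_succ le_rfl)
      (fun j h => hmono j (by omega)) (fun j h => h0 j (by omega)) x
      (fun j h => hbdd j (by omega)) (fun j h => hsplit j (by omega)) (hd := by omega)
    have hint : ENNReal.ofReal (g i x - ⨅ y, g i y) =
        ∫⁻ u in Iio x, ENNReal.ofReal (w (i + 1) u * g (i + 1) u) ∂lebesgue I :=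
      ofReal_sub_iInf (hmono i le_rfl hin) (hbdd i le_rfl hin)
        ((hw.locBdd _).mul (.of_monotone (hmono (i + 1) (by omega) hlt)))
        (fun x => mul_nonneg (hw.pos _ x).le (h0 (i + 1) (by omega) hlt x))
        (fun x y => (hg i le_rfl hlt x y).2) x
    rw [hsplit i le_rfl hin, ENNReal.ofReal_mul (hw.pos i x).le, hint,
      Finset.sum_eq_sum_Ico_succ_bot (by omega), add_assoc]
    congr 1
    simp only [ih']
    rw [lintegral_iterKernel_succ _ _ _ hmn, lintegral_leftKernel hw _ hmn.lintegral_kernel,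
      lintegral_add_right _ hmn.lintegral_kernel, mul_add, lintegral_finsetSum']
    · congr 1
      rw [Finset.mul_sum]
      refine Finset.sum_congr rfl fun j hj => ?_
      rw [Finset.mem_Ico] at hj
      rw [lintegral_const_mul' _ _ ENNReal.ofReal_ne_top, leftPoly_of_lt w (by omega : i < j)]
      ring
    · intro j hj
      rw [Finset.mem_Ico] at hj
      exact ((measurable_leftPoly hw hj.1).const_mul _).aemeasurable

/-- For functions vanishing on the left of `t`, integration from the left endpoint of `I` and from
`t` are the same. -/
theorem setLIntegral_Iio_eq_uIoc [I.OrdConnected] {φ : I → ℝ≥0∞} {t : I}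
    (hφ : ∀ u < t, φ u = 0) (x : I) :
    ∫⁻ u in Iio x, φ u ∂lebesgue I = ∫⁻ u in uIoc t x, φ u ∂lebesgue I := by
  have hz : ∀ s : Set I, MeasurableSet s → s ⊆ Iio t → ∫⁻ u in s, φ u ∂lebesgue I = 0 :=
    fun s hs hst => setLIntegral_eq_zero hs fun u hu => hφ u (hst hu)
  rcases le_total t x with h | h
  · rw [setLIntegral_Iio_add _ h, hz _ measurableSet_Iio subset_rfl, zero_add, uIoc_of_le h]
  · rw [hz _ measurableSet_Iio (Iio_subset_Iio h), uIoc_of_ge h,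
      ← setLIntegral_congr Ioo_ae_eq_Ioc, hz _ measurableSet_Ioo fun u hu => hu.2]

/-- The truncated polynomials are iterated integrals from the left endpoint of `I` as well. -/
theorem enorm_ptPolyPos [I.OrdConnected] (hw : IsGauge w) (t : I) {j m : ℕ} (hjm : j ≤ m) (x : I) :
    ‖ptPolyPos w t j m x‖ₑ =
      ∫⁻ u, ENNReal.ofReal ((Ici t).indicator (w m) u)
        ∂iterKernel (leftKernel w) (m - j) j x := by
  have h0 : ∀ u, 0 ≤ (Ici t).indicator (w m) u :=
    fun u => indicator_nonneg (fun v _ => (hw.pos m v).le) u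
  have hm : Measurable ((Ici t).indicator (w m)) := (hw.measurable m).indicator measurableSet_Ici
  have hb : LocBdd ((Ici t).indicator (w m)) := by
    refine ⟨hm, fun x y => ((hw.locBdd m).2 x y).imp fun C hC u hu => ?_⟩
    refine le_trans ?_ (hC u hu)
    exact norm_indicator_le_norm_self (w m) u
  have hm' := hm.ennreal_ofReal
  induction hd : m - j generalizing j x with
  | zero =>
    rw [lintegral_iterKernel_zero _ _ hm', ptPolyPos_eq_lift w t hjm, hd]
    simp only [lift]
    rw [Real.enorm_of_nonneg (h0 x)]
  | succ d ih =>
    have hlt : j < m := by omega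
    have ih' := fun x => ih (j := j + 1) hlt x (by omega)
    have hstep : ‖ptPolyPos w t j m x‖ₑ = ENNReal.ofReal (w j x) *
        ∫⁻ u in uIoc t x, ‖ptPolyPos w t (j + 1) m u‖ₑ ∂lebesgue I := by
      rw [ptPolyPos_eq_lift w t hjm, ptPolyPos_eq_lift w t hlt, hd,
        show m - (j + 1) = d by omega]
      simp only [lift]
      rw [enorm_mul, Real.enorm_of_nonneg (hw.pos j x).le,
        ((SignPattern.of_nonneg h0 t).lift hw d (j + 1)).enorm_integral (hb.lift hw t d (j + 1))]
    rw [hstep, ← setLIntegral_Iio_eq_uIoc, lintegral_iterKernel_succ _ _ _ hm',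
      lintegral_leftKernel hw _ hm'.lintegral_kernel]
    · simp only [ih']
    · intro u hu
      simp [ptPolyPos, hu.not_ge]

end LeftExpansion

/-! ### The dual cone -/

section DualCone

variable {I : Set ℝ} {w : ℕ → I → ℝ} {z s : I} {ν₁ ν₂ : Measure I}

theorem gDom_antitone {f : I → ℝ} {i n : ℕ} (hi : i ≤ n) (hf : f ∈ gDom w n) : f ∈ gDom w i := by
  induction n, hi using Nat.le_induction with
  | base => exact hf
  | succ n _ ih => exact ih hf.1

theorem measurable_ptPoly [I.OrdConnected] (hw : IsGauge w) (s : I) (i : ℕ) :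
    Measurable (ptPoly w s 0 i) := by
  rw [ptPoly, ptPolyAux_eq_lift]
  exact ((hw.locBdd _).lift hw s _ _).1

/-- The condition on the polynomials of degree at most `N` does not depend on the base point. -/
theorem sameIntegral_ptPoly [I.OrdConnected] (hw : IsGauge w) {N : ℕ}
    (h : ∀ l ≤ N, SameIntegral ν₁ ν₂ (ptPoly w s 0 l)) (z : I) {i : ℕ} (hi : i ≤ N) :
    SameIntegral ν₁ ν₂ (ptPoly w z 0 i) := by
  have htaylor := (isChain_prolong_unitChain hw z i (0 + i)).taylor hw (z := s) i 0
  -- The remainder vanishes, because the derivative of order `i` is constant.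
  have h0 : (fun x => w (0 + i) x * (prolong w z i (unitChain I i) (0 + i) x -
      prolong w z i (unitChain I i) (0 + i) s)) = fun _ => 0 := by
    funext x
    rw [prolong_of_le z _ (by omega)]
    simp [unitChain]
  rw [h0, lift_zero_fun] at htaylor
  rw [ptPoly_eq_mul_prolong hw z i]
  simp only [htaylor, zero_add]
  exact .sum _ _ fun l hl => h l (by have := Finset.mem_range.1 hl; omega)

/-- The chain of the gauged derivatives of `p^+_{t;0,n}`. -/
noncomputable def truncChain (w : ℕ → I → ℝ) (t : I) (n : ℕ) : ℕ → I → ℝ :=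
  prolong w t n fun _ => (Ici t).indicator 1

theorem monotone_indicator_Ici (t : I) : Monotone ((Ici t).indicator (1 : I → ℝ)) := by
  intro x y hxy
  by_cases hx : t ≤ x
  · simp [hx, hx.trans hxy]
  · rw [indicator_of_notMem (show x ∉ Ici t from hx)]
    exact indicator_nonneg (fun _ _ => zero_le_one) _

theorem mul_truncChain [I.OrdConnected] (hw : IsGauge w) (t : I) {n j : ℕ} (hj : j ≤ n) :
    (fun x => w j x * truncChain w t n j x) = ptPolyPos w t j n := by
  rw [truncChain, mul_prolong hw t _ hj, ptPolyPos_eq_lift w t hj]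
  congr 1
  funext u
  by_cases hu : t ≤ u <;> simp [hu]

theorem isChain_truncChain [I.OrdConnected] (hw : IsGauge w) (t : I) (n : ℕ) :
    IsChain w (truncChain w t n) 0 n :=
  isChain_prolong hw (.of_monotone (monotone_indicator_Ici t))
    fun _ hj hj' => absurd hj hj'.not_ge

theorem truncChain_nonneg [I.OrdConnected] (hw : IsGauge w) (t : I) {n j : ℕ} (hj : j ≤ n)
    (x : I) : 0 ≤ truncChain w t n j x := by
  have h1 : 0 ≤ ptPolyPos w t j n x := by
    by_cases hx : t ≤ x
    · rw [ptPolyPos_eq_lift w t hj]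
      exact (((SignPattern.of_nonneg (fun u =>
        indicator_nonneg (fun v _ => (hw.pos n v).le) u) t).lift hw (n - j) j) x).1 hx
    · simp [ptPolyPos, hx]
  rw [← mul_truncChain hw t hj] at h1
  exact nonneg_of_mul_nonneg_right h1 (hw.pos j x)

theorem monotone_truncChain [I.OrdConnected] (hw : IsGauge w) (t : I) {n j : ℕ} (hj : j ≤ n) :
    Monotone (truncChain w t n j) := by
  rcases hj.lt_or_eq with hj | rfl
  · exact (isChain_truncChain hw t n).monotone hw j.zero_le hj (truncChain_nonneg hw t hj)
  · rw [truncChain, prolong_of_le t _ le_rfl]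
    exact monotone_indicator_Ici t

/-- The measure against which `|g|` is integrated to give the integral, against
`signMeasure z (N + 1) μ ν`, of the absolute value of the `e`-fold iterated integral of `g`. -/
noncomputable def transposed [I.OrdConnected] (w : ℕ → I → ℝ) (z : I) (N e : ℕ)
    (μ ν : Measure I) : Measure I :=
  (signMeasure z (N + 1) μ ν).bind (iterKernel (liftKernel w z) e 0)

theorem lintegral_transposed [I.OrdConnected] (hw : IsGauge w) (N e : ℕ) (μ ν : Measure I) {m : ℕ}
    {g : I → ℝ} (hg : SignPattern z m g) (hb : LocBdd g) :
    ∫⁻ x, ‖lift w z e 0 g x‖ₑ ∂signMeasure z (N + 1) μ ν =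
      ∫⁻ u, ‖g u‖ₑ ∂transposed w z N e μ ν := by
  rw [transposed, lintegral_bind_iterKernel _ _ _ _ hb.1.enorm]
  simp only [hg.enorm_lift hw hb]

/-- The comparison of the integrals of a function with a nonnegative gauged derivative of order
`N + 1`, transposed to this derivative. -/
theorem IsChain.extIntegralGE_iff_transposed [I.OrdConnected] (hw : IsGauge w) {g : ℕ → I → ℝ}
    {N : ℕ} (hg : IsChain w g 0 (N + 1)) (h0 : ∀ x, 0 ≤ g (N + 1) x)
    (hb : LocBdd fun x => w (N + 1) x * g (N + 1) x) (hm : Measurable (g 0))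
    (hp : ∀ l ≤ N, SameIntegral ν₁ ν₂ (ptPoly w z 0 l))
    (h1 : ∫⁻ x, ENNReal.ofReal (-(w 0 x * g 0 x)) ∂ν₁ < ∞)
    (h2 : ∫⁻ x, ENNReal.ofReal (-(w 0 x * g 0 x)) ∂ν₂ < ∞) :
    ExtIntegralGE ν₁ ν₂ (fun x => w 0 x * g 0 x) ↔
      ∫⁻ x, ENNReal.ofReal (w (N + 1) x * g (N + 1) x) ∂transposed w z N (N + 1) ν₂ ν₁ ≤
        ∫⁻ x, ENNReal.ofReal (w (N + 1) x * g (N + 1) x) ∂transposed w z N (N + 1) ν₁ ν₂ := by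
  have hmono := hg.monotone hw N.zero_le (Nat.lt_succ_self N) h0
  have h0' : ∀ x, 0 ≤ w (N + 1) x * g (N + 1) x := fun x => mul_nonneg (hw.pos _ x).le (h0 x)
  have hl : lift w z N 0 (fun x => w N x * (g N x - g N z)) =
      lift w z (N + 1) 0 (fun x => w (N + 1) x * g (N + 1) x) := by
    rw [lift_succ_eq_lift, Nat.zero_add]
    congr 1
    funext x
    rw [(hg N N.zero_le (Nat.lt_succ_self N) x z).2, add_sub_cancel_left]
  rw [(hg.mono le_rfl N.le_succ).extIntegralGE_iff (z := z) hw hmono hm hp h1 h2, hl,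
    lintegral_transposed hw _ _ _ _ (SignPattern.of_nonneg h0' z) hb,
    lintegral_transposed hw _ _ _ _ (SignPattern.of_nonneg h0' z) hb]
  simp only [Real.enorm_of_nonneg (h0' _)]

/-- The case of a cone defined by nonnegative derivatives of orders `N + 1, …, n` and a
nondecreasing derivative of order `n`. -/
theorem extIntegralGE_of_mem_coneF_of_le [hI : I.OrdConnected] (hI' : I.Nontrivial)
    (hw : IsGauge w) {N n : ℕ} (hNn : N + 1 ≤ n)
    (hp : ∀ l ≤ N, SameIntegral ν₁ ν₂ (ptPoly w z 0 l))
    (hL : ∀ j ∈ finSet w (N + 1) n, ExtIntegralGE ν₁ ν₂ (leftLift w z 0 (N + 1) j) ∧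
      ⊥ < extIntegral ν₁ (leftLift w z 0 (N + 1) j) ∧
      ⊥ < extIntegral ν₂ (leftLift w z 0 (N + 1) j))
    (hT : ∀ t, ExtIntegralGE ν₁ ν₂ (ptPolyPos w t 0 n) ∧
      ⊥ < extIntegral ν₁ (ptPolyPos w t 0 n) ∧ ⊥ < extIntegral ν₂ (ptPolyPos w t 0 n))
    {f : I → ℝ} (hf : f ∈ coneF w (N + 1) n) (h1 : ⊥ < extIntegral ν₁ f)
    (h2 : ⊥ < extIntegral ν₂ f) : ExtIntegralGE ν₁ ν₂ f := by
  obtain ⟨hdom, hmono⟩ := hf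
  obtain ⟨hch, hLD⟩ := isChain_gDer hw hdom
  have hfm : Measurable f := gDom_antitone n.zero_le hdom
  have hf0 : (fun x => w 0 x * gDer w 0 f x) = f := by
    funext x
    exact mul_div_cancel₀ _ (hw.pos 0 x).ne'
  have hnn : ∀ j, N + 1 ≤ j → j ≤ n → ∀ x, 0 ≤ gDer w j f x := by
    intro j hj hjn
    obtain ⟨j, rfl⟩ : ∃ j', j = j' + 1 := ⟨j - 1, by omega⟩
    exact IsChain.nonneg_of_monotone (g := fun j => gDer w j f) hI' hw
      (hch.mono j.zero_le hjn) (hmono j (by omega) (by omega)) (hmono _ (by omega) hjn)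
      (hLD j (by omega))
  set α := transposed w z N (N + 1) ν₁ ν₂
  set β := transposed w z N (N + 1) ν₂ ν₁
  have hleft : ∀ j ∈ finSet w (N + 1) n,
      ∫⁻ x, leftPoly w (N + 1) j x ∂β ≤ ∫⁻ x, leftPoly w (N + 1) j x ∂α := by
    rintro j hj
    obtain ⟨hGE, hb1, hb2⟩ := hL j hj
    obtain ⟨hkj, hjn, hfin⟩ := hj
    have hlb := locBdd_leftChain hI' hw hfin le_rfl
    have hmul := mul_leftChain hw hkj
    have hc : IsChain w (prolong w z (N + 1) (leftChain w j)) 0 (N + 1) :=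
      isChain_prolong hw hlb (isChain_leftChain hI' hw hfin _)
    have hcont := continuous_prolong (z := z) hw hlb fun l hl => continuous_leftChain hI' hw hfin hl
    rw [leftLift_eq_mul_prolong hw z hkj] at hGE hb1 hb2
    have htop := prolong_of_le (w := w) z (leftChain w j) (le_refl (N + 1))
    rw [hc.extIntegralGE_iff_transposed (z := z) hw (by
        rw [htop]
        exact leftChain_nonneg hw j _) (by
        rw [htop]
        exact (hw.locBdd _).mul hlb) (hcont 0).measurable hp (lintegral_neg_lt_top hb1)
        (lintegral_neg_lt_top hb2), htop] at hGE
    simpa only [congrFun hmul, ENNReal.ofReal_toReal (hfin _).ne] using hGE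
  have htrunc : ∀ t, ∫⁻ x, ‖ptPolyPos w t (N + 1) n x‖ₑ ∂β ≤
      ∫⁻ x, ‖ptPolyPos w t (N + 1) n x‖ₑ ∂α := by
    intro t
    obtain ⟨hGE, hb1, hb2⟩ := hT t
    rw [← mul_truncChain hw t n.zero_le] at hGE hb1 hb2
    rw [((isChain_truncChain hw t n).mono le_rfl hNn).extIntegralGE_iff_transposed (z := z) hw
      (truncChain_nonneg hw t hNn)
      ((hw.locBdd _).mul (.of_monotone (monotone_truncChain hw t hNn)))
      (monotone_truncChain hw t n.zero_le).measurable hp (lintegral_neg_lt_top hb1)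
      (lintegral_neg_lt_top hb2)] at hGE
    rw [← mul_truncChain hw t hNn]
    have hpos : ∀ x, 0 ≤ w (N + 1) x * truncChain w t n (N + 1) x := fun x =>
      mul_nonneg (hw.pos _ x).le (truncChain_nonneg hw t hNn x)
    simpa only [Real.enorm_of_nonneg (hpos _)] using hGE
  rw [← hf0] at h1 h2 ⊢
  have hlb : LocBdd fun x => w (N + 1) x * gDer w (N + 1) f x :=
    (hw.locBdd _).mul (.of_monotone (hmono _ (by omega) hNn))
  rw [IsChain.extIntegralGE_iff_transposed (z := z) (g := fun j => gDer w j f) hw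
    (hch.mono le_rfl hNn) (hnn _ le_rfl hNn) hlb (hfm.div (hw.measurable 0)) hp
    (lintegral_neg_lt_top h1) (lintegral_neg_lt_top h2)]
  have hexp := IsChain.left_expansion (g := fun j => gDer w j f) hw hNn
    (hch.mono (Nat.zero_le _) le_rfl) (fun j h h' => hmono j (by omega) h') hnn
  have : Nonempty I := ⟨z⟩
  set c : ℕ → ℝ := fun j => ⨅ y, gDer w j f y
  have hmn : Measurable (gDer w n f) := (hmono n (by omega) le_rfl).measurable
  have hrem : Measurable (fun u => ENNReal.ofReal (w n u * (gDer w n f u - c n))) :=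
    ((hw.measurable n).mul (hmn.sub_const _)).ennreal_ofReal
  have hterm : ∀ μ : Measure I, ∫⁻ x, ENNReal.ofReal (w (N + 1) x * gDer w (N + 1) f x) ∂μ =
      ∑ j ∈ Finset.Ico (N + 1) (n + 1), ENNReal.ofReal (c j) * ∫⁻ x, leftPoly w (N + 1) j x ∂μ +
        ∫⁻ u, ENNReal.ofReal (gDer w n f u - c n)
          ∂(μ.bind (iterKernel (leftKernel w) (n - (N + 1)) (N + 1))).withDensity
            (fun x => ENNReal.ofReal (w n x)) := by
    intro μ
    rw [lintegral_withDensity_eq_lintegral_mul _ (hw.measurable n).ennreal_ofReal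
      (hmn.sub_const _).ennreal_ofReal]
    simp only [Pi.mul_apply, ← ENNReal.ofReal_mul (hw.pos n _).le]
    rw [lintegral_bind_iterKernel _ _ _ _ hrem]
    simp only [hexp]
    rw [lintegral_add_right _ hrem.lintegral_kernel, lintegral_finsetSum']
    · simp only [lintegral_const_mul' _ _ ENNReal.ofReal_ne_top]
      rfl
    · intro j hj
      rw [Finset.mem_Ico] at hj
      exact ((measurable_leftPoly hw hj.1).const_mul _).aemeasurable
  rw [hterm, hterm]
  refine add_le_add (Finset.sum_le_sum fun j hj => ?_) (lintegral_le_of_monotone (fun t => ?_)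
    (fun x y hxy => sub_le_sub_right (hmono n (by omega) le_rfl hxy) _) fun x => ?_)
  · rw [Finset.mem_Ico] at hj
    rcases eq_or_ne (ENNReal.ofReal (c j)) 0 with hcj | hcj
    · simp [hcj]
    -- A positive limit of the `j`-th derivative forces `p_{a;N+1,j}` to be finite.
    · refine mul_le_mul_right (hleft j ⟨hj.1, by omega, fun x => ?_⟩) _
      have hle : ENNReal.ofReal (c j) * leftPoly w (N + 1) j x ≤
          ENNReal.ofReal (w (N + 1) x * gDer w (N + 1) f x) := by
        rw [hexp x]
        exact (Finset.single_le_sum (f := fun j => ENNReal.ofReal (c j) * leftPoly w (N + 1) j x)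
          (fun _ _ => zero_le) (Finset.mem_Ico.2 hj)).trans le_self_add
      by_contra hcon
      rw [not_lt, top_le_iff] at hcon
      rw [hcon, ENNReal.mul_top hcj, top_le_iff] at hle
      exact ENNReal.ofReal_ne_top hle
  · have hind : ∀ μ : Measure I,
        ((μ.bind (iterKernel (leftKernel w) (n - (N + 1)) (N + 1))).withDensity
          (fun x => ENNReal.ofReal (w n x))) (Ici t) =
        ∫⁻ x, ‖ptPolyPos w t (N + 1) n x‖ₑ ∂μ := by
      intro μ
      simp only [enorm_ptPolyPos hw t hNn]
      rw [withDensity_apply _ measurableSet_Ici, ← lintegral_indicator measurableSet_Ici,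
        ← lintegral_bind_iterKernel _ _ _ _
          ((hw.measurable n).indicator measurableSet_Ici).ennreal_ofReal]
      refine lintegral_congr fun x => ?_
      by_cases hx : t ≤ x <;> simp [hx]
    rw [hind, hind]
    exact htrunc t
  · exact sub_nonneg.2 (ciInf_le ⟨0, by rintro _ ⟨y, rfl⟩; exact hnn n hNn le_rfl y⟩ x)

/-- The case of a cone defined by the monotonicity of the derivative of order `n` alone. -/
theorem extIntegralGE_of_mem_coneF_succ [hI : I.OrdConnected] (hw : IsGauge w) {n : ℕ}
    (hp : ∀ l ≤ n, SameIntegral ν₁ ν₂ (ptPoly w z 0 l))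
    (hT : ∀ t, ExtIntegralGE ν₁ ν₂ (ptPolyPos w t 0 n) ∧
      ⊥ < extIntegral ν₁ (ptPolyPos w t 0 n) ∧ ⊥ < extIntegral ν₂ (ptPolyPos w t 0 n))
    {f : I → ℝ} (hf : f ∈ coneF w (n + 1) n) (h1 : ⊥ < extIntegral ν₁ f)
    (h2 : ⊥ < extIntegral ν₂ f) : ExtIntegralGE ν₁ ν₂ f := by
  obtain ⟨hdom, hmono⟩ := hf
  obtain ⟨hch, -⟩ := isChain_gDer hw hdom
  have hfm : Measurable f := gDom_antitone n.zero_le hdom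
  have hf0 : (fun x => w 0 x * gDer w 0 f x) = f := by
    funext x
    exact mul_div_cancel₀ _ (hw.pos 0 x).ne'
  have hmn := hmono n le_rfl le_rfl
  have hwm := (hw.measurable n).ennreal_ofReal
  set α := (transposed w z n n ν₁ ν₂).withDensity fun x => ENNReal.ofReal (w n x)
  set β := (transposed w z n n ν₂ ν₁).withDensity fun x => ENNReal.ofReal (w n x)
  have hval : ∀ μ ν : Measure I, ∀ {g : I → ℝ}, Monotone g →
      ∫⁻ x, ‖lift w z n 0 (fun x => w n x * (g x - g z)) x‖ₑ ∂signMeasure z (n + 1) μ ν =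
      ∫⁻ x, ‖g x - g z‖ₑ ∂(transposed w z n n μ ν).withDensity
        fun x => ENNReal.ofReal (w n x) := by
    intro μ ν g hg
    have hm : Measurable fun x => ‖g x - g z‖ₑ := (hg.measurable.sub_const _).enorm
    rw [lintegral_transposed hw _ _ _ _ ((SignPattern.of_monotone hg z).mul_left (hw.pos n))
      ((hw.locBdd n).mul ((LocBdd.of_monotone hg).sub (.const _))),
      lintegral_withDensity_eq_lintegral_mul _ hwm hm]
    simp only [Pi.mul_apply, enorm_mul, Real.enorm_of_nonneg (hw.pos n _).le]
  -- The total masses are the integrals of the absolute value of `p_{z;0,n}`.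
  have hfin : ∀ μ ν : Measure I, Integrable (ptPoly w z 0 n) μ → Integrable (ptPoly w z 0 n) ν →
      IsFiniteMeasure ((transposed w z n n μ ν).withDensity fun x => ENNReal.ofReal (w n x)) := by
    intro μ ν hμ hν
    refine isFiniteMeasure_withDensity (ne_of_lt ?_)
    have := lintegral_signMeasure_lt_top (z := z) (n + 1) hμ hν
    rw [ptPoly, ptPolyAux_eq_lift] at this
    simp only [Nat.sub_zero, Nat.zero_add] at this
    rw [lintegral_transposed hw _ _ _ _ (SignPattern.of_nonneg (fun x => (hw.pos n x).le) z)
      (hw.locBdd n)] at this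
    simpa only [Real.enorm_of_nonneg (hw.pos n _).le] using this
  have : IsFiniteMeasure α := hfin _ _ (hp n le_rfl).1 (hp n le_rfl).2
  have : IsFiniteMeasure β := hfin _ _ (hp n le_rfl).2 (hp n le_rfl).1
  have htrunc : ∀ t, ∫⁻ x, ‖(Ici t).indicator 1 x - (Ici t).indicator (1 : I → ℝ) z‖ₑ ∂β ≤
      ∫⁻ x, ‖(Ici t).indicator 1 x - (Ici t).indicator (1 : I → ℝ) z‖ₑ ∂α := by
    intro t
    obtain ⟨hGE, hb1, hb2⟩ := hT t
    rw [← mul_truncChain hw t n.zero_le] at hGE hb1 hb2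
    rw [(isChain_truncChain hw t n).extIntegralGE_iff (z := z) hw
      (monotone_truncChain hw t le_rfl) (monotone_truncChain hw t n.zero_le).measurable hp
      (lintegral_neg_lt_top hb1) (lintegral_neg_lt_top hb2),
      hval _ _ (monotone_truncChain hw t le_rfl), hval _ _ (monotone_truncChain hw t le_rfl),
      truncChain, prolong_of_le t _ le_rfl] at hGE
    exact hGE
  rw [← hf0] at h1 h2 ⊢
  rw [IsChain.extIntegralGE_iff (z := z) (g := fun j => gDer w j f) hw hch hmn
    (hfm.div (hw.measurable 0)) hp (lintegral_neg_lt_top h1) (lintegral_neg_lt_top h2),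
    hval _ _ hmn, hval _ _ hmn]
  refine lintegral_enorm_sub_le_of_monotone (fun t ht => ?_) (fun t ht => ?_) hmn
  · have hind : ∀ μ : Measure I,
        ∫⁻ x, ‖(Ici t).indicator 1 x - (Ici t).indicator (1 : I → ℝ) z‖ₑ ∂μ = μ (Ici t) := by
      intro μ
      rw [← lintegral_indicator_one measurableSet_Ici]
      refine lintegral_congr fun x => ?_
      by_cases hx : t ≤ x <;> simp [hx, ht.not_ge]
    simpa only [hind] using htrunc t
  · have hind : ∀ μ : Measure I,
        ∫⁻ x, ‖(Ici t).indicator 1 x - (Ici t).indicator (1 : I → ℝ) z‖ₑ ∂μ = μ (Iio t) := by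
      intro μ
      rw [← lintegral_indicator_one measurableSet_Iio]
      refine lintegral_congr fun x => ?_
      by_cases hx : t ≤ x
      · simp [hx, ht, hx.not_gt]
      · simp [hx, ht, not_le.1 hx]
    simpa only [hind] using htrunc t

theorem sameIntegral_of_mem_dualCone {G : Set (I → ℝ)} {p : I → ℝ} (hm : Measurable p)
    (h : (ν₁, ν₂) ∈ dualCone G) (hp : p ∈ G) (hnp : (fun x => -p x) ∈ G) :
    SameIntegral ν₁ ν₂ p := by
  obtain ⟨h1, h2, hGE⟩ := h
  have hint : ∀ ν ∈ admissible G, Integrable p ν := by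
    intro ν hν
    have := lintegral_neg_lt_top (hν _ hnp).2
    simp only [neg_neg] at this
    exact integrable_of_lintegral_lt_top hm this (lintegral_neg_lt_top (hν _ hp).2)
  have i1 := hint _ h1
  have i2 := hint _ h2
  have e1 := (extIntegralGE_iff_of_integrable i1 i2).1 (hGE _ hp)
  have e2 := (extIntegralGE_iff_of_integrable i1.neg i2.neg).1 (hGE _ hnp)
  simp only [Pi.neg_apply, integral_neg] at e2
  exact ⟨i1, i2, by linarith⟩

end DualCone

end GaugedCone

theorem mainTheorem3 (I : Set ℝ) (hI : I.OrdConnected) (hI' : I.Nontrivial)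
    (w : ℕ → I → ℝ) (hw : GaugedCone.IsGauge w)
    (k n : ℕ) (hk : 1 ≤ k) (hkn : k ≤ n + 1)
    (G : Set (I → ℝ))
    (hGl : GaugedCone.wPolyCone w k n ∪ {p | ∃ t : I, p = GaugedCone.ptPolyPos w t 0 n} ⊆ G)
    (hGu : G ⊆ GaugedCone.coneF w k n)
    (ν₁ ν₂ : MeasureTheory.Measure I)
    (hν₁ : ν₁ ∈ GaugedCone.admissible G) (hν₂ : ν₂ ∈ GaugedCone.admissible G)
    (s z : I) :
    (ν₁, ν₂) ∈ GaugedCone.dualCone G ↔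
      (∀ i : ℕ, i ≤ k - 1 →
        GaugedCone.ExtIntegralEqReal ν₁ ν₂ (GaugedCone.ptPoly w s 0 i)) ∧
      (∀ j ∈ GaugedCone.finSet w k n,
        GaugedCone.ExtIntegralGE ν₁ ν₂ (GaugedCone.leftLift w z 0 k j)) ∧
      (∀ t : I, GaugedCone.ExtIntegralGE ν₁ ν₂ (GaugedCone.ptPolyPos w t 0 n)) := by
  have hleft : ∀ j ∈ GaugedCone.finSet w k n, GaugedCone.leftLift w z 0 k j ∈ G := fun j hj =>
    hGl (Or.inl (GaugedCone.leftLift_mem_wPolyCone hI hI' hw hj z))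
  have htrunc : ∀ t, GaugedCone.ptPolyPos w t 0 n ∈ G := fun t => hGl (Or.inr ⟨t, rfl⟩)
  constructor
  · intro h
    refine ⟨fun i hi => ?_, fun j hj => h.2.2 _ (hleft j hj), fun t => h.2.2 _ (htrunc t)⟩
    obtain ⟨hp, hnp⟩ := GaugedCone.ptPoly_mem_wPolyCone hI hI' hw (by omega : i < k) hkn s
    exact (GaugedCone.sameIntegral_of_mem_dualCone (GaugedCone.measurable_ptPoly hw s i) h
      (hGl (Or.inl hp)) (hGl (Or.inl hnp))).extIntegralEqReal
  · rintro ⟨hP, hL, hT⟩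
    obtain ⟨N, rfl⟩ : ∃ N, k = N + 1 := ⟨k - 1, by omega⟩
    have hp : ∀ l ≤ N, GaugedCone.SameIntegral ν₁ ν₂ (GaugedCone.ptPoly w z 0 l) := fun l hl =>
      GaugedCone.sameIntegral_ptPoly hw (fun i hi =>
        (hP i (by omega)).sameIntegral (GaugedCone.measurable_ptPoly hw s i)) z hl
    have hT' := fun t => 
      And.intro (hT t) (And.intro (hν₁ _ (htrunc t)).2 (hν₂ _ (htrunc t)).2)
    refine ⟨hν₁, hν₂, fun f hf => ?_⟩
    rcases Nat.lt_or_ge n (N + 1) with hn | hn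
    · obtain rfl : N = n := by omega
      exact GaugedCone.extIntegralGE_of_mem_coneF_succ hw hp hT' (hGu hf) (hν₁ f hf).2
        (hν₂ f hf).2
    · exact GaugedCone.extIntegralGE_of_mem_coneF_of_le hI' hw hn hp
        (fun j hj => ⟨hL j hj, (hν₁ _ (hleft j hj)).2, (hν₂ _ (hleft j hj)).2⟩) hT' (hGu hf)
        (hν₁ f hf).2 (hν₂ f hf).2
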